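/- **Setting.** Fix $d\in\mathbb N=\{0,1,\dots\}$, types $\mathfrak L=\{\Xi,\mathcal I\}$ (noise, kernel) and edge types $\mathcal E=\mathfrak L\times\mathbb N^d$, written $\mathfrak t_k=(\mathfrak t,k)$. Fix a scaling $\mathfrak s\in[1,\infty)^d$ and degrees $|\Xi|<0<|\mathcal I|$, and set $|k|=\sum_i k_i\mathfrak s_i$, $|\mathfrak t_k|=|\mathfrak t|-|k|$. A rule is a set $R$ of finite multisets of elements of $\mathcal E$. It is normal if $A\subset B\in R$ implies $A\in R$, and subcritical if there is $\mathrm{reg}:\mathfrak L\to\mathbb R$ with $\mathrm{reg}(\Xi)<|\Xi|$ and $\mathrm{reg}(\mathcal I)<|\mathcal I|+\inf_{N\in R}\sum_{(\mathfrak t,k)\in N}(\mathrm{reg}(\mathfrak t)-|k|)$. Let $R$ be normal and subcritical. *Trees.* $\mathfrak T^{\rm ex}$ is the set of isomorphism classes of finite rooted trees $\tau=(T,\mathfrak n,\mathfrak o,\mathfrak e)$ with $\mathfrak n:N_T\to\mathbb N^d$, $\mathfrak o:N_T\to\mathbb R$, $\mathfrak e:E_T\to\mathcal E$, in which the upper node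 of every noise edge (a noise node) is a leaf on which $\mathfrak n$ and $\mathfrak o$ vanish. $\mathcal V^{\rm ex}$ is the span of $\mathfrak T^{\rm ex}$. $\mathbf 1^a$ is the one-node tree with $\mathfrak n=0$, $\mathfrak o=a$. $\mathcal N(x)$ is the multiset of types of the edges leaving the node $x$ away from the root, and $|\tau|=\sum_{x}|\mathfrak n(x)|+\sum_{e}|\mathfrak e(e)|$. $\mathfrak T_\circ$ is the set of trees with $\mathfrak o=0$ and $\mathcal N(x)\in R$ for all nodes $x$. A tree is planted if $\mathfrak n$ vanishes at the root and exactly one edge leaves the root. $\mathfrak T_-$ is the set of $\tau\in\mathfrak T_\circ$ that are not planted, with $|\tau|<0$ and $\mathfrak n=0$ at the root. *Extraction and contraction.* Let $A\subset T$ be a subgraph, $\partial A$ the set of edges $(x,y)\notin E_A$ with $x\in N_A$ the end nearer to the root, $\mathfrak n_A:N_A\to\mathbb N^d$ with $\mathfrak n_A\le\mathfrak n$, $\mathfrak e_A:\partial A\to\mathbb N^d$, and $\pi\mathfrak e_A(x)$ the sum of $\mathfrak e_A$ over the boundary edges leaving $x$. The extracted forest $\mathscr E(\tau;A,\mathfrak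 n_A,\mathfrak e_A)$ is the multiset of connected components of $(A,\mathfrak n_A+\pi\mathfrak e_A,\mathfrak o|_{N_A},\mathfrak e|_{E_A})$. The contracted tree $\mathscr C(\tau;A,\mathfrak n_A,\mathfrak e_A)$ is obtained from $T$ by contracting each component of $A$ to a node; its edge decoration is $\mathfrak e+\mathfrak e_A$, its polynomial decoration is $\mathfrak n-\mathfrak n_A$ summed over each component, and its extended decoration at the node of a component $B$ is $\sum_{x\in N_B}(\mathfrak o(x)+|\mathfrak n_A(x)+\pi\mathfrak e_A(x)|)+\sum_{e\in E_B}|\mathfrak e(e)|$ (other decorations are unchanged). $\mathfrak T^{\rm ex}_\circ$ is the set of all $\mathscr C(\tau;A,\mathfrak n_A,\mathfrak e_A)$ with $\tau\in\mathfrak T_\circ$ such that all components of $\mathscr E(\tau;A,\mathfrak n_A,\mathfrak e_A)$ are in $\mathfrak T_-$. For $a\in\mathbb R$ let $\tilde R(a)$ be the set of the multisets $\mathcal N(\text{root of }\tau)$ over $\tau\in\mathfrak T^{\rm ex}_\circ$ whose extended decoration at the root is $a$. *Negative characters.* $\mathfrak T^{\rm ex}_-$ is the set of non-planted $\tau\in\mathfrak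 T^{\rm ex}_\circ$ with $|\tau|<0$ and $\mathfrak n=0$ at the root; $\mathcal F^{\rm ex}_-$ is the free commutative algebra generated by $\mathfrak T_-^{\rm ex}$, with basis the forests (finite multisets) of such trees; $G_-^{\rm ex}$ is the group of characters (unital algebra morphisms $\mathcal F^{\rm ex}_-\to\mathbb R$). Set $$\Delta^-_{\rm ex}\tau=\sum_{A,\mathfrak n_A,\mathfrak e_A}\frac1{\mathfrak e_A!}\binom{\mathfrak n}{\mathfrak n_A}\,\pi_-\mathscr E(\tau;A,\mathfrak n_A,\mathfrak e_A)\otimes\mathscr C(\tau;A,\mathfrak n_A,\mathfrak e_A)\in\mathcal F^{\rm ex}_-\otimes\mathcal V^{\rm ex},$$ where $\pi_-$ kills every forest not made of trees in $\mathfrak T_-^{\rm ex}$, and $M_g=(g\otimes\mathrm{id})\Delta^-_{\rm ex}$. Let $\langle\cdot,\cdot\rangle$ be the inner product on $\mathcal V^{\rm ex}$ for which distinct trees are orthogonal and $\langle\tau,\tau\rangle=\tau!$, where $\tau!=k!\prod_i\alpha_i!\prod_j(\tau_j!)^{\beta_j}\beta_j!$ if the root of $\tau$ has polynomial decoration $k$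 and carries $\alpha_i$ noise edges of each of the distinct types $\Xi_{l_i}$ and $\beta_j$ copies of each of the distinct kernel branches $\mathcal I_{m_j}[\tau_j]$. Put $M_g^*\sigma=\sum_{\tau\in\mathfrak T^{\rm ex}_\circ}\frac{\langle\sigma,M_g\tau\rangle}{\tau!}\tau$. *Non-linearities.* A non-linearity is a smooth $F:\mathbb R^{\mathcal E}\to\mathbb R$ depending on finitely many components; $D_o$ is the partial derivative in the component $o\in\mathcal E$ and $\mathcal Y_o$ the evaluation of that component. $F$ obeys $R$ if $D_{o_1}\cdots D_{o_n}F=0$ whenever the multiset $\{o_1,\dots,o_n\}$ is not in $R$. Let $\partial^iF=\sum_{p\in\mathbb N^d}\mathcal Y_{(\mathcal I,p+e_i)}D_{(\mathcal I,p)}F$, and let $\partial^k$ ($k\in\mathbb N^d$) be the composition of these commuting operators. For a family $\mathbf F=\{F_a\}_{a\le0}$ of non-linearities, only finitely many non-zero, set $F_a=0$ for $a>0$ and define $\Upsilon^{\mathbf F}$ on trees recursively by $$\Upsilon^{\mathbf F}[\tau]=\Big(\prod_{j\in J}\Upsilon^{\mathbf F}[\tau_j]\Big)\cdot\Big(\partial^k\prod_{j\in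 J}D_{(\mathcal I,m_j)}\prod_{l\in L}D_{(\Xi,l)}\Big)F_a$$ when the root of $\tau$ has decorations $\mathfrak n=k$, $\mathfrak o=a$ and carries the noise edges $\Xi_l$ ($l\in L$) and the kernel branches $\mathcal I_{m_j}[\tau_j]$ ($j\in J$); extend linearly. For $g\in G_-^{\rm ex}$ let $\mathbf F^g=\{F^g_a\}$ with $F_a^g=\Upsilon^{\mathbf F}[M_g^*\mathbf 1^a]$. The orbit $F^{G_-^{\rm ex}}$ of a non-linearity $F$ is $\{\mathbf F^g: g\in G_-^{\rm ex}\}$ where $\mathbf F$ is the family with $F_0=F$ and $F_a=0$ for $a\neq0$. **Proposition.** Suppose that the non-linearity $F$ obeys $R$ and let $\mathbf F=\{F_a\}\in F^{G_-^{\rm ex}}$. Then: 1. for every $a\in\mathbb R$ and every finite multiset $O$ of edge types with $O\notin\tilde R(a)$, one has $\big(\prod_{o\in O}D_o\big)F_a=0$; 2. $\Upsilon^{\mathbf F}[\tau]=0$ for every $\tau\in\mathfrak T^{\rm ex}\setminus\mathfrak T^{\rm ex}_\circ$. -/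

import Mathlib

open scoped TensorProduct ContDiff

noncomputable section

namespace RegTrees

/-! ### Edge types, degrees, rules -/

/-- The two types of edges: `noise` stands for `Ξ` and `kernel` for `𝓘`. -/
inductive EdgeKind : Type
  | noise : EdgeKind
  | kernel : EdgeKind

/-- Edge types: pairs of a type and a multi-index in `ℕ^d`. -/
abbrev EdgeType (d : ℕ) : Type := EdgeKind × (Fin d → ℕ)

/-- A scaling in `[1,∞)^d` with degrees of the two types, `|Ξ| < 0 < |𝓘|`. -/
structure DegreeMap (d : ℕ) where
  scale : Fin d → ℝ
  one_le_scale : ∀ i, 1 ≤ scale i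
  deg : EdgeKind → ℝ
  noise_neg : deg EdgeKind.noise < 0
  kernel_pos : 0 < deg EdgeKind.kernel

namespace DegreeMap

variable {d : ℕ}

/-- `|k| = ∑ i, k i * s i`. -/
def polyDeg (δ : DegreeMap d) (k : Fin d → ℕ) : ℝ := ∑ i, (k i : ℝ) * δ.scale i

/-- `|𝔱_k| = |𝔱| - |k|`. -/
def edgeDeg (δ : DegreeMap d) (o : EdgeType d) : ℝ := δ.deg o.1 - δ.polyDeg o.2

end DegreeMap

/-- A rule (a set of multisets of edge types) is normal if it is closed under sub-multisets. -/
def IsNormal {d : ℕ} (R : Set (Multiset (EdgeType d))) : Prop :=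
  ∀ A B : Multiset (EdgeType d), A ≤ B → B ∈ R → A ∈ R

/-- Subcriticality; the number `c` is a lower bound for `reg N`, `N ∈ R`, so that the last two
clauses say `reg 𝓘 < |𝓘| + inf_{N ∈ R} reg N` (with infimum `+∞` for the empty rule). -/
def IsSubcritical {d : ℕ} (δ : DegreeMap d) (R : Set (Multiset (EdgeType d))) : Prop :=
  ∃ reg : EdgeKind → ℝ, reg EdgeKind.noise < δ.deg EdgeKind.noise ∧
    ∃ c : ℝ, (∀ N ∈ R, c ≤ (N.map fun o => reg o.1 - δ.polyDeg o.2).sum) ∧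
      reg EdgeKind.kernel < δ.deg EdgeKind.kernel + c

/-! ### Decorated rooted trees -/

/-- A finite rooted tree with decorations. Edges are oriented away from the root and are identified
with their upper end: the node `v ≠ root` stands for the edge `(parent v, v)`. The value of `edge`
at the root carries no meaning. `poly` is the polynomial decoration and `ext` the extended one. -/
structure DecTree (d : ℕ) : Type 1 where
  Node : Type
  fintypeNode : Fintype Node
  root : Node
  parent : Node → Node
  parent_root : parent root = root
  reaches_root : ∀ v, ∃ k : ℕ, parent^[k] v = root
  poly : Node → Fin d → ℕ
  ext : Node → ℝ
  edge : Node → EdgeType d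
  noise_leaf : ∀ v, v ≠ root → (edge v).1 = EdgeKind.noise →
    (∀ w, w ≠ root → parent w ≠ v) ∧ poly v = 0 ∧ ext v = 0

namespace DecTree

variable {d : ℕ}

instance (τ : DecTree d) : Fintype τ.Node := τ.fintypeNode

instance (τ : DecTree d) : DecidableEq τ.Node := Classical.decEq _

/-- Isomorphism of decorated rooted trees. -/
def Iso (τ σ : DecTree d) : Prop :=
  ∃ φ : τ.Node ≃ σ.Node, φ τ.root = σ.root ∧ (∀ v, φ (τ.parent v) = σ.parent (φ v)) ∧
    (∀ v, σ.poly (φ v) = τ.poly v) ∧ (∀ v, σ.ext (φ v) = τ.ext v) ∧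
    ∀ v, v ≠ τ.root → σ.edge (φ v) = τ.edge v

theorem Iso.refl (τ : DecTree d) : Iso τ τ :=
  ⟨Equiv.refl _, rfl, fun _ => rfl, fun _ => rfl, fun _ => rfl, fun _ _ => rfl⟩

theorem Iso.symm {τ σ : DecTree d} : Iso τ σ → Iso σ τ := by
  rintro ⟨φ, h1, h2, h3, h4, h5⟩
  refine ⟨φ.symm, by simp [← h1], fun v => ?_, fun v => ?_, fun v => ?_, fun v hv => ?_⟩
  · apply φ.injective
    simp [h2]
  · simpa using (h3 (φ.symm v)).symm
  · simpa using (h4 (φ.symm v)).symm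
  · have hv' : φ.symm v ≠ τ.root := by
      intro h
      apply hv
      rw [← h1, ← h]
      simp
    simpa using (h5 _ hv').symm

theorem Iso.trans {τ σ ρ : DecTree d} : Iso τ σ → Iso σ ρ → Iso τ ρ := by
  rintro ⟨φ, h1, h2, h3, h4, h5⟩ ⟨ψ, k1, k2, k3, k4, k5⟩
  refine ⟨φ.trans ψ, by simp [h1, k1], fun v => by simp [h2, k2], fun v => by simp [h3, k3],
    fun v => by simp [h4, k4], fun v hv => ?_⟩
  have hv' : φ v ≠ σ.root := by
    intro h
    exact hv (φ.injective (h.trans h1.symm))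
  simp [h5 v hv, k5 _ hv']

instance isoSetoid (d : ℕ) : Setoid (DecTree d) where
  r := Iso
  iseqv := ⟨Iso.refl, Iso.symm, Iso.trans⟩

end DecTree

/-- The set `𝔗^ex` of combinatorial trees: decorated trees up to isomorphism. -/
def TreeClass (d : ℕ) : Type 1 := Quotient (DecTree.isoSetoid d)

namespace DecTree

variable {d : ℕ}

/-- The isomorphism class of a tree. -/
def toClass (τ : DecTree d) : TreeClass d := Quotient.mk _ τ

/-- The upper ends of the edges leaving `x`. -/
def children (τ : DecTree d) (x : τ.Node) : Finset τ.Node :=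
  Finset.univ.filter fun v => v ≠ τ.root ∧ τ.parent v = x

/-- The multiset `𝓝(x)` of the types of the edges leaving `x`. -/
def outEdges (τ : DecTree d) (x : τ.Node) : Multiset (EdgeType d) :=
  (τ.children x).val.map τ.edge

/-- Noise nodes are the upper ends of noise edges. -/
def IsNoiseNode (τ : DecTree d) (x : τ.Node) : Prop :=
  x ≠ τ.root ∧ (τ.edge x).1 = EdgeKind.noise

/-- The degree `|τ|_𝔰`, which ignores the extended decoration. -/
def degree (δ : DegreeMap d) (τ : DecTree d) : ℝ :=
  ∑ v, δ.polyDeg (τ.poly v) + ∑ v ∈ Finset.univ.filter (fun v => v ≠ τ.root), δ.edgeDeg (τ.edge v)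

/-- The tree belongs to `𝔗` (no extended decoration) and strongly conforms to the rule `R`. -/
def Conforms (R : Set (Multiset (EdgeType d))) (τ : DecTree d) : Prop :=
  (∀ x, τ.ext x = 0) ∧ ∀ x, τ.outEdges x ∈ R

/-- `τ = 𝟏^p Ξ_l` or `τ = 𝟏^p 𝓘_m[σ]`. -/
def IsPlanted (τ : DecTree d) : Prop :=
  τ.poly τ.root = 0 ∧ (τ.children τ.root).card = 1

/-- The tree `𝟏^a` with one node, with extended decoration `a`. -/
def unit (d : ℕ) (a : ℝ) : DecTree d where
  Node := Unit
  fintypeNode := inferInstance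
  root := ()
  parent := id
  parent_root := rfl
  reaches_root := fun _ => ⟨0, rfl⟩
  poly := fun _ => 0
  ext := fun _ => a
  edge := fun _ => (EdgeKind.kernel, 0)
  noise_leaf := fun _ hv => absurd rfl hv

theorem iterate_root (τ : DecTree d) (k : ℕ) : τ.parent^[k] τ.root = τ.root :=
  Function.iterate_fixed τ.parent_root k

open Classical in
/-- The part of the tree above the node `y`, with root `y`. -/
def subtree (τ : DecTree d) (y : τ.Node) : DecTree d where
  Node := {v : τ.Node // ∃ k : ℕ, τ.parent^[k] v = y}
  fintypeNode := inferInstance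
  root := ⟨y, 0, rfl⟩
  parent := fun v => if h : v.1 = y then v else ⟨τ.parent v.1, by
    obtain ⟨v, k, hk⟩ := v
    cases k with
    | zero => exact absurd hk h
    | succ k => exact ⟨k, by simpa using hk⟩⟩
  parent_root := by simp
  reaches_root := by
    rintro ⟨v, k, hk⟩
    induction k generalizing v with
    | zero => exact ⟨0, Subtype.ext hk⟩
    | succ k ih =>
      by_cases h : v = y
      · exact ⟨0, Subtype.ext h⟩
      · obtain ⟨j, hj⟩ := ih (τ.parent v) (by simpa using hk)
        refine ⟨j + 1, ?_⟩
        rw [Function.iterate_succ_apply]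
        simpa [h] using hj
  poly := fun v => τ.poly v.1
  ext := fun v => τ.ext v.1
  edge := fun v => τ.edge v.1
  noise_leaf := by
    have key : ∀ v : {v : τ.Node // ∃ k : ℕ, τ.parent^[k] v = y}, v.1 ≠ y → v.1 ≠ τ.root := by
      rintro ⟨v, k, hk⟩ h h'
      apply h
      have h'' : v = τ.root := h'
      have h3 : τ.parent^[k] v = v := by rw [h'', τ.iterate_root]
      exact h3.symm.trans hk
    intro v hv hn
    have hv' : v.1 ≠ y := fun h => hv (Subtype.ext h)
    obtain ⟨h1, h2, h3⟩ := τ.noise_leaf v.1 (key v hv') hn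
    refine ⟨fun w hw => ?_, h2, h3⟩
    have hw' : w.1 ≠ y := fun h => hw (Subtype.ext h)
    intro h
    rw [dif_neg hw'] at h
    exact h1 w.1 (key w hw') (congrArg Subtype.val h)

open Classical in
/-- The branches leaving `x`: the types of the edges together with the trees on which they end. -/
def branches (τ : DecTree d) (x : τ.Node) : Multiset (EdgeType d × TreeClass d) :=
  (τ.children x).val.map fun y => (τ.edge y, (τ.subtree y).toClass)

open Classical in
/-- The factorial `τ!`. The recursion
`τ! = k! ∏ α_i! ∏ (τ_j!)^{β_j} β_j!`, where `α_i`, `β_j` are the multiplicities of the distinct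
branches at the root, is written out as a product over all nodes. -/
def treeFactorial (τ : DecTree d) : ℕ :=
  ∏ x, (∏ i, (τ.poly x i).factorial) *
    ∏ b ∈ (τ.branches x).toFinset, ((τ.branches x).count b).factorial

end DecTree

/-! ### Extraction and contraction of subforests -/

/-- A subgraph `A` of the tree (node set `nodes`, edge set `edges`, with edges represented by their
upper ends), with a polynomial decoration `nA ≤ 𝔫` on its nodes and a decoration `eA` of its
boundary, that is, of the edges that leave a node of `A` but do not belong to `A`. Both are
extended by zero. -/
structure Extraction {d : ℕ} (τ : DecTree d) where
  nodes : Finset τ.Node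
  edges : Finset τ.Node
  edges_ne_root : ∀ v ∈ edges, v ≠ τ.root
  edges_upper : ∀ v ∈ edges, v ∈ nodes
  edges_lower : ∀ v ∈ edges, τ.parent v ∈ nodes
  nA : τ.Node → Fin d → ℕ
  nA_le : ∀ v, nA v ≤ τ.poly v
  nA_support : ∀ v, v ∉ nodes → nA v = 0
  eA : τ.Node → Fin d → ℕ
  eA_support : ∀ v, ¬ (v ≠ τ.root ∧ v ∉ edges ∧ τ.parent v ∈ nodes) → eA v = 0

namespace Extraction

variable {d : ℕ} {τ : DecTree d}

theorem root_not_mem (P : Extraction τ) : τ.root ∉ P.edges :=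
  fun h => P.edges_ne_root _ h rfl

theorem exists_top (P : Extraction τ) (v : τ.Node) : ∃ k : ℕ, τ.parent^[k] v ∉ P.edges := by
  obtain ⟨k, hk⟩ := τ.reaches_root v
  exact ⟨k, hk ▸ P.root_not_mem⟩

/-- The lowest node of the connected component of `v` in the graph formed by all nodes of the tree
and the edges of `A`. Contracted components are represented by their lowest node. -/
def top (P : Extraction τ) (v : τ.Node) : τ.Node :=
  τ.parent^[Nat.find (P.exists_top v)] v

theorem top_not_mem (P : Extraction τ) (v : τ.Node) : P.top v ∉ P.edges :=
  Nat.find_spec (P.exists_top v)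

theorem top_of_not_mem (P : Extraction τ) {v : τ.Node} (h : v ∉ P.edges) : P.top v = v := by
  have : Nat.find (P.exists_top v) = 0 := by
    rw [Nat.find_eq_zero]
    exact h
  simp [top, this]

theorem top_of_mem (P : Extraction τ) {v : τ.Node} (h : v ∈ P.edges) :
    P.top v = P.top (τ.parent v) := by
  have h0 : ¬ (τ.parent^[0] v ∉ P.edges) := by simpa using h
  have h1 : ∃ k : ℕ, τ.parent^[k + 1] v ∉ P.edges := by
    obtain ⟨k, hk⟩ := P.exists_top (τ.parent v)
    exact ⟨k, by simpa using hk⟩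
  have : Nat.find (P.exists_top v) = Nat.find (P.exists_top (τ.parent v)) + 1 := by
    rw [Nat.find_comp_succ (P.exists_top v) h1 h0]
    congr 1
  rw [top, this, Function.iterate_succ_apply]
  rfl

theorem top_noise (P : Extraction τ) {v u : τ.Node} (hv : ∀ w, w ≠ τ.root → τ.parent w ≠ v)
    (h : P.top u = v) : u = v := by
  obtain ⟨k, hk⟩ : ∃ k : ℕ, τ.parent^[k] u = v := ⟨_, h⟩
  clear h
  induction k generalizing u with
  | zero => exact hk
  | succ k ih =>
    have h' := ih (u := τ.parent u) (by simpa using hk)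
    by_cases hu : u = τ.root
    · rw [← h', hu, τ.parent_root]
    · exact absurd h' (hv u hu)

/-- The sum `π e_A` of the boundary decorations over the edges leaving a node. -/
def piE (P : Extraction τ) (x : τ.Node) : Fin d → ℕ := ∑ v ∈ τ.children x, P.eA v

theorem piE_noise (P : Extraction τ) {v : τ.Node} (hv : ∀ w, w ≠ τ.root → τ.parent w ≠ v) :
    P.piE v = 0 := by
  unfold piE
  apply Finset.sum_eq_zero
  intro w hw
  simp only [DecTree.children, Finset.mem_filter, Finset.mem_univ, true_and] at hw
  exact absurd hw.2 (hv w hw.1)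

/-- The component of `A` with lowest node `w`, decorated by `𝔫_A + π 𝔢_A`, `𝔬` and `𝔢`. -/
def component (P : Extraction τ) (w : τ.Node) (hw : w ∉ P.edges) : DecTree d where
  Node := {v : τ.Node // P.top v = w}
  fintypeNode := inferInstance
  root := ⟨w, P.top_of_not_mem hw⟩
  parent := fun v => if h : v.1 ∈ P.edges then
    ⟨τ.parent v.1, by rw [← P.top_of_mem h]; exact v.2⟩ else v
  parent_root := by simp [hw]
  reaches_root := by
    rintro ⟨v, hv⟩
    obtain ⟨k, hk⟩ : ∃ k : ℕ, τ.parent^[k] v = w := ⟨_, hv⟩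
    induction k generalizing v with
    | zero => exact ⟨0, Subtype.ext hk⟩
    | succ k ih =>
      by_cases h : v ∈ P.edges
      · obtain ⟨j, hj⟩ := ih (τ.parent v) (by rw [← P.top_of_mem h]; exact hv) (by simpa using hk)
        refine ⟨j + 1, ?_⟩
        rw [Function.iterate_succ_apply]
        simpa [h] using hj
      · exact ⟨0, Subtype.ext ((P.top_of_not_mem h).symm.trans hv)⟩
  poly := fun v => P.nA v.1 + P.piE v.1
  ext := fun v => τ.ext v.1
  edge := fun v => τ.edge v.1
  noise_leaf := by
    have key : ∀ v : {v : τ.Node // P.top v = w}, v.1 ≠ w → v.1 ∈ P.edges := by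
      rintro ⟨v, hv⟩ h
      by_contra h'
      exact h ((P.top_of_not_mem h').symm.trans hv)
    intro v hv hn
    have hv' : v.1 ≠ w := fun h => hv (Subtype.ext h)
    obtain ⟨h1, h2, h3⟩ := τ.noise_leaf v.1 (P.edges_ne_root _ (key v hv')) hn
    refine ⟨fun u hu => ?_, ?_, h3⟩
    · have hu' : u.1 ≠ w := fun h => hu (Subtype.ext h)
      intro h
      rw [dif_pos (key u hu')] at h
      exact h1 u.1 (P.edges_ne_root _ (key u hu')) (congrArg Subtype.val h)
    · have h4 : P.nA v.1 = 0 := by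
        have := P.nA_le v.1
        rw [h2] at this
        exact le_antisymm this (fun _ => Nat.zero_le _)
      rw [h4, P.piE_noise h1, add_zero]

/-- The extracted forest: the multiset of the connected components of `A`. -/
def forest (P : Extraction τ) : Multiset (TreeClass d) :=
  (Finset.univ : Finset {w : τ.Node // w ∈ P.nodes ∧ w ∉ P.edges}).val.map
    fun w => (P.component w.1 w.2.2).toClass

/-- The contracted tree: the components of `A` become nodes, `𝔫 - 𝔫_A` is summed over components,
`𝔢_A` is added to the decorations of the remaining edges, and the extended decoration collects
`𝔬`, the degrees of the contracted edges and `|𝔫_A + π 𝔢_A|`. -/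
def contract (δ : DegreeMap d) (P : Extraction τ) : DecTree d where
  Node := {v : τ.Node // v ∉ P.edges}
  fintypeNode := inferInstance
  root := ⟨τ.root, P.root_not_mem⟩
  parent := fun v => ⟨P.top (τ.parent v.1), P.top_not_mem _⟩
  parent_root := by
    apply Subtype.ext
    simp only [τ.parent_root]
    exact P.top_of_not_mem P.root_not_mem
  reaches_root := by
    rintro ⟨v, hv⟩
    obtain ⟨n, hn⟩ := τ.reaches_root v
    induction n using Nat.strong_induction_on generalizing v with
    | _ n ih =>
      cases n with
      | zero => exact ⟨0, Subtype.ext hn⟩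
      | succ n =>
        have hn' : τ.parent^[n] (τ.parent v) = τ.root := by simpa using hn
        have hlt : n - Nat.find (P.exists_top (τ.parent v)) < n + 1 := by omega
        obtain ⟨j, hj⟩ := ih _ hlt (P.top (τ.parent v)) (P.top_not_mem _) (by
          rw [top, ← Function.iterate_add_apply]
          obtain ⟨m, hm⟩ : ∃ m, n - Nat.find (P.exists_top (τ.parent v)) +
              Nat.find (P.exists_top (τ.parent v)) = m + n :=
            ⟨n - Nat.find (P.exists_top (τ.parent v)) +
              Nat.find (P.exists_top (τ.parent v)) - n, by omega⟩
          rw [hm, Function.iterate_add_apply, hn', τ.iterate_root])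
        exact ⟨j + 1, by rw [Function.iterate_succ_apply]; exact hj⟩
  poly := fun w => ∑ v ∈ Finset.univ.filter (fun v => P.top v = w.1), (τ.poly v - P.nA v)
  ext := fun w =>
    ∑ v ∈ Finset.univ.filter (fun v => P.top v = w.1), (τ.ext v + δ.polyDeg (P.nA v + P.piE v)) +
      ∑ v ∈ P.edges.filter (fun v => P.top v = w.1), δ.edgeDeg (τ.edge v)
  edge := fun v => ((τ.edge v.1).1, (τ.edge v.1).2 + P.eA v.1)
  noise_leaf := by
    intro v hv hn
    have hv' : v.1 ≠ τ.root := fun h => hv (Subtype.ext h)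
    obtain ⟨h1, h2, h3⟩ := τ.noise_leaf v.1 hv' hn
    have h4 : P.nA v.1 = 0 := by
      have := P.nA_le v.1
      rw [h2] at this
      exact le_antisymm this (fun _ => Nat.zero_le _)
    refine ⟨fun w hw h => ?_, ?_, ?_⟩
    · exact h1 w.1 (fun h => hw (Subtype.ext h)) (P.top_noise h1 (congrArg Subtype.val h))
    · apply Finset.sum_eq_zero
      intro u hu
      have hu' := P.top_noise h1 (Finset.mem_filter.mp hu).2
      rw [hu', h2, h4]
      rfl
    · have e1 : ∑ u ∈ Finset.univ.filter (fun u => P.top u = v.1),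
          (τ.ext u + δ.polyDeg (P.nA u + P.piE u)) = 0 := by
        apply Finset.sum_eq_zero
        intro u hu
        have hu' := P.top_noise h1 (Finset.mem_filter.mp hu).2
        rw [hu', h3, h4, P.piE_noise h1]
        simp [DegreeMap.polyDeg]
      have e2 : ∑ u ∈ P.edges.filter (fun u => P.top u = v.1), δ.edgeDeg (τ.edge u) = 0 := by
        apply Finset.sum_eq_zero
        intro u hu
        have hu' := P.top_noise h1 (Finset.mem_filter.mp hu).2
        exact absurd (hu' ▸ (Finset.mem_filter.mp hu).1) v.2
      rw [e1, e2, add_zero]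

/-- The combinatorial coefficient `binom(𝔫, 𝔫_A) / 𝔢_A!`. -/
def coeff (P : Extraction τ) : ℝ :=
  (∏ v, ∏ i, ((τ.poly v i).choose (P.nA v i) : ℝ)) / ∏ v, ∏ i, ((P.eA v i).factorial : ℝ)

end Extraction

/-! ### Conforming trees, negative trees, and the group of negative characters -/

section Renormalisation

variable {d : ℕ} (δ : DegreeMap d) (R : Set (Multiset (EdgeType d)))

/-- `𝔗_-`: conforming trees without extended decoration, of negative degree, without polynomial
decoration at the root, and not planted. -/
def negTrees : Set (TreeClass d) :=
  {c | ∃ τ : DecTree d, τ.toClass = c ∧ τ.Conforms R ∧ τ.degree δ < 0 ∧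
    τ.poly τ.root = 0 ∧ ¬ τ.IsPlanted}

/-- `𝔗_∘^ex`: the trees obtained from conforming trees by extracting forests of negative trees. -/
def extTrees : Set (TreeClass d) :=
  {c | ∃ (τ : DecTree d) (P : Extraction τ), τ.Conforms R ∧ (∀ t ∈ P.forest, t ∈ negTrees δ R) ∧
    (P.contract δ).toClass = c}

/-- `R̃(a)`: the edge types leaving the root of a tree of `𝔗_∘^ex` with extended decoration `a` at
the root. -/
def extRule (a : ℝ) : Set (Multiset (EdgeType d)) :=
  {N | ∃ τ : DecTree d, τ.toClass ∈ extTrees δ R ∧ τ.ext τ.root = a ∧ τ.outEdges τ.root = N}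

/-- `𝔗_-^ex`. -/
def negExtTrees : Set (TreeClass d) :=
  {c | ∃ τ : DecTree d, τ.toClass = c ∧ c ∈ extTrees δ R ∧ τ.degree δ < 0 ∧
    τ.poly τ.root = 0 ∧ ¬ τ.IsPlanted}

/-- `𝔉_-^ex`: forests of trees of `𝔗_-^ex`, with the forest product written additively. -/
def negForests : AddSubmonoid (Multiset (TreeClass d)) where
  carrier := {f | ∀ t ∈ f, t ∈ negExtTrees δ R}
  zero_mem' := by simp
  add_mem' := by
    intro f g hf hg t ht
    rcases Multiset.mem_add.mp ht with h | h
    · exact hf t h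
    · exact hg t h

/-- The algebra `𝓕_-^ex` spanned by `𝔉_-^ex`. -/
abbrev NegAlgebra : Type 1 := AddMonoidAlgebra ℝ (negForests δ R)

/-- The group `G_-^ex` of characters of `𝓕_-^ex`. -/
abbrev NegChar : Type 1 := NegAlgebra δ R →ₐ[ℝ] ℝ

open Classical in
/-- The projection `π_-^ex` of forests to `𝓕_-^ex`. -/
def projNeg (f : Multiset (TreeClass d)) : NegAlgebra δ R :=
  if h : f ∈ negForests δ R then AddMonoidAlgebra.single ⟨f, h⟩ 1 else 0

/-- The space `𝓥^ex` spanned by `𝔗^ex`. -/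
abbrev TreeSpace (d : ℕ) : Type 1 := TreeClass d →₀ ℝ

/-- `Δ^-_ex τ` for a tree `τ`. Only finitely many terms of the sum are non-zero. -/
def coactTree (τ : DecTree d) : NegAlgebra δ R ⊗[ℝ] TreeSpace d :=
  ∑ᶠ P : Extraction τ,
    P.coeff • (projNeg δ R P.forest ⊗ₜ[ℝ] Finsupp.single (P.contract δ).toClass (1 : ℝ))

/-- The linear map `Δ^-_ex`, computed on any representatives of isomorphism classes. -/
def coaction : TreeSpace d →ₗ[ℝ] NegAlgebra δ R ⊗[ℝ] TreeSpace d :=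
  Finsupp.linearCombination ℝ fun c : TreeClass d => coactTree δ R (Quotient.out c)

variable {δ R}

/-- `M_g = (g ⊗ id) Δ^-_ex`. -/
def renorm (g : NegChar δ R) : TreeSpace d →ₗ[ℝ] TreeSpace d :=
  (TensorProduct.lid ℝ (TreeSpace d)).toLinearMap ∘ₗ
    LinearMap.rTensor (TreeSpace d) g.toLinearMap ∘ₗ coaction δ R

/-- The factorial of an isomorphism class. -/
def classFactorial (c : TreeClass d) : ℝ := ((Quotient.out c : DecTree d).treeFactorial : ℝ)

/-- The inner product on `𝓥^ex` for which trees are orthogonal with `⟨τ, τ⟩ = τ!`. -/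
def treeInner (u v : TreeSpace d) : ℝ := u.sum fun c x => x * v c * classFactorial c

open Classical in
/-- The adjoint `M_g^* σ = ∑_{τ ∈ 𝔗_∘^ex} (⟨σ, M_g τ⟩ / τ!) τ`, as the function that assigns to a
tree its coefficient. -/
def renormAdj (g : NegChar δ R) (u : TreeSpace d) : TreeClass d → ℝ := fun c =>
  if c ∈ extTrees δ R then treeInner u (renorm g (Finsupp.single c 1)) / classFactorial c else 0

end Renormalisation

/-! ### Non-linearities and the coherence map -/

section Nonlinearities

variable {d : ℕ}

/-- Functions on `ℝ^𝓔`. -/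
abbrev JetFun (d : ℕ) : Type := (EdgeType d → ℝ) → ℝ

/-- A non-linearity: a smooth function of finitely many components. -/
def IsNonlinearity (F : JetFun d) : Prop :=
  ∃ (s : Finset (EdgeType d)) (f : (s → ℝ) → ℝ), ContDiff ℝ ∞ f ∧
    ∀ y : EdgeType d → ℝ, F y = f fun o => y o

open Classical in
/-- The partial derivative `D_o`. -/
def pderiv (o : EdgeType d) (F : JetFun d) : JetFun d := fun y =>
  deriv (fun t : ℝ => F (Function.update y o t)) (y o)

/-- `D_{o_1} ⋯ D_{o_n} F` for the list `[o_1, …, o_n]`. -/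
def pderivs (l : List (EdgeType d)) (F : JetFun d) : JetFun d := l.foldr pderiv F

/-- `F` obeys the rule `R`. -/
def Obeys (F : JetFun d) (R : Set (Multiset (EdgeType d))) : Prop :=
  ∀ l : List (EdgeType d), (l : Multiset (EdgeType d)) ∉ R → pderivs l F = 0

/-- `∂^i F = ∑_p Y_{(𝓘, p + e_i)} D_{(𝓘, p)} F`, a finite sum when `F` is a non-linearity. -/
def shiftDeriv (i : Fin d) (F : JetFun d) : JetFun d := fun y =>
  ∑ᶠ p : Fin d → ℕ, y (EdgeKind.kernel, p + Pi.single i 1) * pderiv (EdgeKind.kernel, p) F y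

/-- `∂^k`, the composition of the commuting operators `∂^i`, each applied `k i` times. -/
def shiftDerivs (k : Fin d → ℕ) (F : JetFun d) : JetFun d :=
  (List.finRange d).foldr (fun i G => (shiftDeriv i)^[k i] G) F

open Classical in
/-- The coherence map `Υ` of the family `FF` on a tree. The recursion
`Υ[τ] = (∏_j Υ[τ_j]) · (∂^k ∏_j D_{(𝓘, m_j)} ∏_l D_{(Ξ, l)}) F_a` is written out as a product over
all nodes that are not noise nodes. Derivatives commute, so their order does not matter. -/
def upsilon (FF : ℝ → JetFun d) (τ : DecTree d) : JetFun d :=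
  ∏ x ∈ Finset.univ.filter (fun x => ¬ τ.IsNoiseNode x),
    shiftDerivs (τ.poly x) (pderivs (τ.outEdges x).toList (FF (τ.ext x)))

/-- The linear extension of `Υ` to combinations of trees, given by their coefficients. -/
def upsilonLin (FF : ℝ → JetFun d) (u : TreeClass d → ℝ) : JetFun d :=
  ∑ᶠ c : TreeClass d, u c • upsilon FF (Quotient.out c : DecTree d)

/-- The reduced extended non-linearity given by `F`. Families of non-linearities indexed by `a ≤ 0`
are extended by zero to all real `a`. -/
def reduced (F : JetFun d) : ℝ → JetFun d := Pi.single 0 F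

variable {δ : DegreeMap d} {R : Set (Multiset (EdgeType d))}

/-- The action of `G_-^ex` on extended non-linearities, `F^g_a = Υ[M_g^* 𝟏^a]`. -/
def act (FF : ℝ → JetFun d) (g : NegChar δ R) : ℝ → JetFun d := fun a =>
  upsilonLin FF (renormAdj g (Finsupp.single (DecTree.unit d a).toClass 1))

variable (δ R)

/-- The orbit of a non-linearity under `G_-^ex`. -/
def orbit (F : JetFun d) : Set (ℝ → JetFun d) :=
  Set.range fun g : NegChar δ R => act (reduced F) g

end Nonlinearities

end RegTrees

end

/-!
By contraposition, every non-zero derivative must be explained by a tree that conforms to `R`.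

If `D_O F_a^g ≠ 0`, then some term `D_O Υ[σ] ≠ 0` occurs, where `σ` contracts to `1^a`; that is, `σ`
is a negative tree of degree `a`, or a single node and `a = 0`. By the Leibniz rule each `D_o` acts
on the factor of `Υ[σ]` at one node `y`. There the commutation relation
`[D_(𝓘, p + e_i), ∂^i] = D_(𝓘, p)` may lower `o` at the expense of the polynomial decoration of `y`.
What remains at `y` is a non-zero derivative of `F`, so that the edges leaving `y` in `σ`, together
with the lowered edges attached to `y`, form an element of `R`. The lowering is the decoration `𝔢_A`
of an extraction, and the unused part of the polynomial decoration is `𝔫_A`.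

If `Υ[τ] ≠ 0`, this applies at every node `x` of `τ`, with `O` the edges leaving `x`. Replacing each
node by its tree `σ` gives a tree that conforms to `R`, and the extraction of all the trees `σ`
contracts it to `τ`. The first claim is the case of a corolla.
-/

namespace RegTrees

section IteratedDerivations

variable {S A ι κ : Type*} [CommSemiring S] [CommSemiring A] [Algebra S A]

theorem derivation_prod [DecidableEq κ] (D : Derivation S A A) (T : Finset κ) (f : κ → A) :
    D (∏ y ∈ T, f y) = ∑ y ∈ T, ∏ z ∈ T, Function.update f y (D (f y)) z := by
  induction T using Finset.induction_on with
  | empty => simp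
  | insert a T ha ih =>
    have prod_update : ∀ y ∈ T, ∏ z ∈ insert a T, Function.update f y (D (f y)) z =
        f a * ∏ z ∈ T, Function.update f y (D (f y)) z := fun y hy => by
      rw [Finset.prod_insert ha, Function.update_of_ne (ne_of_mem_of_not_mem hy ha).symm]
    rw [Finset.prod_insert ha, D.leibniz, ih, Finset.sum_insert ha,
      Finset.sum_congr rfl prod_update, Finset.prod_update_of_mem (Finset.mem_insert_self a T),
      Finset.sdiff_singleton_eq_erase, Finset.erase_insert ha, ← Finset.mul_sum,
      smul_eq_mul, smul_eq_mul, add_comm, mul_comm (D (f a))]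

/-- The composition `D v₁ ∘ ⋯ ∘ D vₙ` for the word `l = [v₁, …, vₙ]`. -/
def derivWord (D : ι → Derivation S A A) (l : List ι) : Module.End S A :=
  (l.map fun v => (D v).toLinearMap).prod

variable (D : ι → Derivation S A A)

@[simp]
theorem derivWord_nil (a : A) : derivWord D [] a = a := rfl

@[simp]
theorem derivWord_cons (v : ι) (l : List ι) (a : A) :
    derivWord D (v :: l) a = D v (derivWord D l a) := rfl

theorem derivWord_append (l l' : List ι) (a : A) :
    derivWord D (l ++ l') a = derivWord D l (derivWord D l' a) := by
  simp [derivWord]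

theorem derivWord_comp (g : κ → ι) (l : List κ) :
    derivWord (fun v => D (g v)) l = derivWord D (l.map g) := by
  simp [derivWord, Function.comp_def]

theorem derivWord_congr {D D' : ι → Derivation S A A} {l : List ι} (h : ∀ v ∈ l, D v = D' v) :
    derivWord D l = derivWord D' l := by
  rw [derivWord, derivWord, List.map_congr_left fun v hv => by rw [h v hv]]

theorem derivWord_eq_of_perm {D : ι → Derivation S A A}
    (comm : ∀ v w a, D v (D w a) = D w (D v a)) {l l' : List ι} (h : l.Perm l') (a : A) :
    derivWord D l a = derivWord D l' a := by
  induction h with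
  | nil => rfl
  | cons v _ ih => rw [derivWord_cons, derivWord_cons, ih]
  | swap v w l => exact comm _ _ _
  | trans _ _ ih ih' => exact ih.trans ih'

/-- One term of the Leibniz expansion survives; in it, `D v` acts on the factor `a v`. -/
theorem exists_assignment_of_derivWord_prod_ne_zero [DecidableEq κ] [Nonempty κ]
    {T : Finset κ} {f : κ → A} {l : List ι} (hl : l.Nodup)
    (h : derivWord D l (∏ y ∈ T, f y) ≠ 0) :
    ∃ a : ι → κ, (∀ v ∈ l, a v ∈ T) ∧
      ∏ y ∈ T, derivWord D (l.filter fun v => a v = y) (f y) ≠ 0 := by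
  classical
  induction l using List.reverseRecOn generalizing f with
  | nil => exact ⟨fun _ => Classical.arbitrary κ, by simp, by simpa using h⟩
  | append_singleton l v ih =>
    obtain ⟨hl, -, hv⟩ := List.nodup_append'.mp hl
    replace hv : v ∉ l := by simpa using hv
    rw [derivWord_append, derivWord_cons, derivWord_nil, derivation_prod, map_sum] at h
    obtain ⟨y, hy, hne⟩ := Finset.exists_ne_zero_of_sum_ne_zero h
    obtain ⟨a, haT, ha⟩ := ih hl hne
    have update_a : ∀ w ∈ l, Function.update a v y w = a w := fun w hw =>
      Function.update_of_ne (ne_of_mem_of_not_mem hw hv) _ _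
    refine ⟨Function.update a v y, fun w hw => ?_, ?_⟩
    · rcases List.mem_append.mp hw with hw | hw
      · exact update_a w hw ▸ haT w hw
      · simpa [List.mem_singleton.mp hw] using hy
    · convert ha using 2 with z
      have hfilter : (l.filter fun w => Function.update a v y w = z) =
          l.filter fun w => a w = z :=
        List.filter_congr fun w hw => by rw [update_a w hw]
      rw [List.filter_append, hfilter]
      obtain rfl | hz := eq_or_ne y z
      · simp [derivWord_append]
      · simp [hz, hz.symm]

end IteratedDerivations

/-! ### The algebra of non-linearities -/

theorem hasDerivAt_comp_restrict_update {α : Type*} [DecidableEq α] {s : Finset α}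
    {f : (s → ℝ) → ℝ} (hf : Differentiable ℝ f) (o : α) (y : α → ℝ) (t : ℝ) :
    HasDerivAt (fun t => f (s.restrict (Function.update y o t)))
      (fderiv ℝ f (s.restrict (Function.update y o t)) (s.restrict (Pi.single o 1 : α → ℝ))) t :=
  (hf _).hasFDerivAt.comp_hasDerivAt t <| hasDerivAt_pi.mpr fun p =>
    hasDerivAt_pi.mp (hasDerivAt_update y o t) p

variable {d : ℕ}

open Classical in
theorem pderiv_comp_restrict {s : Finset (EdgeType d)} {f : (s → ℝ) → ℝ}
    (hf : Differentiable ℝ f) (o : EdgeType d) :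
    pderiv o (fun y => f (s.restrict y)) =
      fun y => fderiv ℝ f (s.restrict y) (s.restrict (Pi.single o 1 : EdgeType d → ℝ)) := by
  ext y
  have := (hasDerivAt_comp_restrict_update hf o y (y o)).deriv
  rwa [Function.update_eq_self] at this

namespace IsNonlinearity

variable {F G : JetFun d}

theorem exists_eq_comp_restrict (hF : IsNonlinearity F) :
    ∃ (s : Finset (EdgeType d)) (f : (s → ℝ) → ℝ), ContDiff ℝ ∞ f ∧
      F = fun y => f (s.restrict y) :=
  let ⟨s, f, hf, hF⟩ := hF
  ⟨s, f, hf, funext hF⟩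

theorem exists_pair_eq_comp_restrict (hF : IsNonlinearity F) (hG : IsNonlinearity G) :
    ∃ (s : Finset (EdgeType d)) (f g : (s → ℝ) → ℝ), ContDiff ℝ ∞ f ∧ ContDiff ℝ ∞ g ∧
      (F = fun y => f (s.restrict y)) ∧ G = fun y => g (s.restrict y) := by
  classical
  obtain ⟨s, f, hf, rfl⟩ := hF.exists_eq_comp_restrict
  obtain ⟨t, g, hg, rfl⟩ := hG.exists_eq_comp_restrict
  refine ⟨s ∪ t,
    f ∘ Finset.restrict₂ (π := fun _ => ℝ) (s := s) (t := s ∪ t) Finset.subset_union_left,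
    g ∘ Finset.restrict₂ (π := fun _ => ℝ) (s := t) (t := s ∪ t) Finset.subset_union_right,
    hf.comp ?_, hg.comp ?_, rfl, rfl⟩ <;>
  exact contDiff_pi.mpr fun o => contDiff_apply ℝ ℝ _

theorem add (hF : IsNonlinearity F) (hG : IsNonlinearity G) : IsNonlinearity (F + G) := by
  obtain ⟨s, f, g, hf, hg, rfl, rfl⟩ := hF.exists_pair_eq_comp_restrict hG
  exact ⟨s, f + g, hf.add hg, fun _ => rfl⟩

theorem mul (hF : IsNonlinearity F) (hG : IsNonlinearity G) : IsNonlinearity (F * G) := by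
  obtain ⟨s, f, g, hf, hg, rfl, rfl⟩ := hF.exists_pair_eq_comp_restrict hG
  exact ⟨s, f * g, hf.mul hg, fun _ => rfl⟩

theorem pderiv (hF : IsNonlinearity F) (o : EdgeType d) : IsNonlinearity (pderiv o F) := by
  obtain ⟨s, f, hf, rfl⟩ := hF.exists_eq_comp_restrict
  rw [pderiv_comp_restrict (hf.differentiable (by simp))]
  exact ⟨s, fun z => fderiv ℝ f z _, (hf.fderiv_right (by simp)).clm_apply contDiff_const,
    fun _ => rfl⟩

open Classical in
theorem differentiableAt_update (hF : IsNonlinearity F) (o : EdgeType d) (y : EdgeType d → ℝ)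
    (t : ℝ) : DifferentiableAt ℝ (fun t => F (Function.update y o t)) t := by
  obtain ⟨s, f, hf, rfl⟩ := hF.exists_eq_comp_restrict
  exact (hasDerivAt_comp_restrict_update (hf.differentiable (by simp)) o y t).differentiableAt

theorem finite_pderiv_ne_zero (hF : IsNonlinearity F) :
    {o | RegTrees.pderiv o F ≠ 0}.Finite := by
  classical
  obtain ⟨s, f, hf, rfl⟩ := hF.exists_eq_comp_restrict
  refine s.finite_toSet.subset fun o ho => ?_
  contrapose! ho
  have restrict_single : s.restrict (Pi.single o 1 : EdgeType d → ℝ) = 0 := by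
    ext p
    exact Pi.single_eq_of_ne (ne_of_mem_of_not_mem p.2 ho) 1
  rw [Set.mem_ofPred_eq, not_not, pderiv_comp_restrict (hf.differentiable (by simp))]
  simp only [restrict_single, map_zero]
  rfl

theorem pderiv_comm (hF : IsNonlinearity F) (o o' : EdgeType d) :
    RegTrees.pderiv o (RegTrees.pderiv o' F) = RegTrees.pderiv o' (RegTrees.pderiv o F) := by
  classical
  obtain ⟨s, f, hf, rfl⟩ := hF.exists_eq_comp_restrict
  have hf' : ContDiff ℝ ∞ (fderiv ℝ f) := hf.fderiv_right (by simp)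
  have pderiv_pderiv (o o' : EdgeType d) : RegTrees.pderiv o (RegTrees.pderiv o'
      fun y => f (s.restrict y)) = fun y => fderiv ℝ (fderiv ℝ f) (s.restrict y)
        (s.restrict (Pi.single o 1 : EdgeType d → ℝ))
        (s.restrict (Pi.single o' 1 : EdgeType d → ℝ)) := by
    rw [pderiv_comp_restrict (hf.differentiable (by simp)),
      pderiv_comp_restrict (f := fun z => fderiv ℝ f z _)
        ((hf'.clm_apply contDiff_const).differentiable (by simp))]
    ext y
    rw [fderiv_clm_apply (hf'.differentiable (by simp) _) (differentiableAt_const _)]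
    simp
  rw [pderiv_pderiv, pderiv_pderiv]
  ext y
  exact hf.contDiffAt.isSymmSndFDerivAt (by
    rw [minSmoothness_of_isRCLikeNormedField]
    exact WithTop.coe_le_coe.mpr le_top) _ _

end IsNonlinearity

variable (d) in
/-- The algebra of non-linearities. -/
def nonlinearities : Subalgebra ℝ (JetFun d) where
  carrier := {F | IsNonlinearity F}
  mul_mem' := .mul
  add_mem' := .add
  algebraMap_mem' c := ⟨∅, fun _ => c, contDiff_const, fun _ => rfl⟩

/-- The coordinate `𝓨_o`, as a non-linearity. -/
def coordinate (o : EdgeType d) : nonlinearities d :=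
  ⟨fun y => y o, {o}, fun z => z ⟨o, Finset.mem_singleton_self o⟩, contDiff_apply ℝ ℝ _,
    fun _ => rfl⟩

/-- The partial derivative `D_o`, as a derivation of the algebra of non-linearities. -/
noncomputable def pderivation (o : EdgeType d) :
    Derivation ℝ (nonlinearities d) (nonlinearities d) :=
  .mk'
    { toFun F := ⟨pderiv o F, F.2.pderiv o⟩
      map_add' F G := by
        ext y
        exact deriv_add (F.2.differentiableAt_update o y (y o))
          (G.2.differentiableAt_update o y (y o))
      map_smul' c F := by
        ext y
        exact deriv_const_mul c (F.2.differentiableAt_update o y (y o)) }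
    fun F G => by
      ext y
      have := deriv_mul (F.2.differentiableAt_update o y (y o))
        (G.2.differentiableAt_update o y (y o))
      simp only [Function.update_eq_self] at this
      refine this.trans ?_
      change _ = F.1 y * pderiv o G.1 y + G.1 y * pderiv o F.1 y
      rw [add_comm, mul_comm (deriv _ _)]
      rfl

@[simp]
theorem coe_pderivation (o : EdgeType d) (F : nonlinearities d) :
    (pderivation o F : JetFun d) = pderiv o F := rfl

theorem pderivation_comm (o o' : EdgeType d) (F : nonlinearities d) :
    pderivation o (pderivation o' F) = pderivation o' (pderivation o F) :=
  Subtype.ext (F.2.pderiv_comm o o')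

theorem pderivation_coordinate_self (o : EdgeType d) : pderivation o (coordinate o) = 1 := by
  ext y
  simp [coordinate, pderiv]

theorem pderivation_coordinate_of_ne {o o' : EdgeType d} (h : o' ≠ o) :
    pderivation o (coordinate o') = 0 := by
  ext y
  simp [coordinate, pderiv, h]

/-- The part of the sum defining `∂^i` over the multi-indices `p ∈ s`. -/
noncomputable def partialShift (i : Fin d) (s : Finset (Fin d → ℕ)) :
    Derivation ℝ (nonlinearities d) (nonlinearities d) :=
  ∑ p ∈ s, coordinate (EdgeKind.kernel, p + Pi.single i 1) • pderivation (EdgeKind.kernel, p)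

theorem partialShift_apply (i : Fin d) (s : Finset (Fin d → ℕ)) (F : nonlinearities d) :
    partialShift i s F = ∑ p ∈ s, coordinate (EdgeKind.kernel, p + Pi.single i 1) *
      pderivation (EdgeKind.kernel, p) F := by
  rw [partialShift, ← Derivation.coeFnAddMonoidHom_apply, map_sum, Finset.sum_apply]
  rfl

theorem eventually_partialShift_eq (i : Fin d) (F : nonlinearities d) :
    ∀ᶠ s in Filter.atTop, (partialShift i s F : JetFun d) = shiftDeriv i F := by
  have finite : {p : Fin d → ℕ | pderiv (EdgeKind.kernel, p) (F : JetFun d) ≠ 0}.Finite :=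
    F.2.finite_pderiv_ne_zero.preimage (Prod.mk_right_injective EdgeKind.kernel).injOn
  filter_upwards [Filter.eventually_ge_atTop finite.toFinset] with s hs
  ext y
  rw [shiftDeriv, finsum_eq_sum_of_support_subset (s := s)]
  · simp [partialShift_apply, coordinate]
  · intro p hp
    refine hs (finite.mem_toFinset.mpr fun h => hp ?_)
    simp [h]

/-- The operator `∂^i`, as a derivation of the algebra of non-linearities. -/
noncomputable def shiftDerivation (i : Fin d) :
    Derivation ℝ (nonlinearities d) (nonlinearities d) :=
  .mk'
    { toFun F := ⟨shiftDeriv i F,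
        let ⟨_, hF⟩ := (eventually_partialShift_eq i F).exists
        hF ▸ Subtype.property _⟩
      map_add' F G := by
        obtain ⟨s, hFG, hF, hG⟩ := ((eventually_partialShift_eq i (F + G)).and
          ((eventually_partialShift_eq i F).and (eventually_partialShift_eq i G))).exists
        refine Subtype.ext (hFG.symm.trans ?_)
        simp [hF, hG]
      map_smul' c F := by
        obtain ⟨s, hcF, hF⟩ :=
          ((eventually_partialShift_eq i (c • F)).and (eventually_partialShift_eq i F)).exists
        refine Subtype.ext (hcF.symm.trans ?_)
        simp [hF] }
    fun F G => by
      obtain ⟨s, hFG, hF, hG⟩ := ((eventually_partialShift_eq i (F * G)).and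
        ((eventually_partialShift_eq i F).and (eventually_partialShift_eq i G))).exists
      refine Subtype.ext (hFG.symm.trans ?_)
      simp [hF, hG]

@[simp]
theorem coe_shiftDerivation (i : Fin d) (F : nonlinearities d) :
    (shiftDerivation i F : JetFun d) = shiftDeriv i F := rfl

theorem eventually_partialShift_eq_shiftDerivation (i : Fin d) (F : nonlinearities d) :
    ∀ᶠ s in Filter.atTop, partialShift i s F = shiftDerivation i F :=
  (eventually_partialShift_eq i F).mono fun _ h => Subtype.ext h

theorem pderivation_shiftDerivation (o : EdgeType d) (i : Fin d) (F : nonlinearities d) :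
    pderivation o (shiftDerivation i F) = shiftDerivation i (pderivation o F) ∨
    ∃ q : Fin d → ℕ, o = (EdgeKind.kernel, q + Pi.single i 1) ∧
      pderivation o (shiftDerivation i F) = shiftDerivation i (pderivation o F) +
        pderivation (EdgeKind.kernel, q) F := by
  have expand (s : Finset (Fin d → ℕ)) : pderivation o (partialShift i s F) =
      partialShift i s (pderivation o F) + ∑ p ∈ s, pderivation (EdgeKind.kernel, p) F *
        pderivation o (coordinate (EdgeKind.kernel, p + Pi.single i 1)) := by
    simp [partialShift_apply, pderivation_comm o, Finset.sum_add_distrib]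
  obtain ⟨s₀, hs₀⟩ := Filter.eventually_atTop.mp
    ((eventually_partialShift_eq_shiftDerivation i F).and
      (eventually_partialShift_eq_shiftDerivation i (pderivation o F)))
  by_cases ho : ∃ q : Fin d → ℕ, o = (EdgeKind.kernel, q + Pi.single i 1)
  · obtain ⟨q, rfl⟩ := ho
    obtain ⟨hF, hoF⟩ := hs₀ (insert q s₀) (Finset.subset_insert _ _)
    refine .inr ⟨q, rfl, ?_⟩
    rw [← hF, ← hoF, expand, Finset.sum_eq_single_of_mem q (Finset.mem_insert_self q s₀),
      pderivation_coordinate_self, mul_one]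
    intro p _ hp
    rw [pderivation_coordinate_of_ne (by simpa using hp), mul_zero]
  · obtain ⟨hF, hoF⟩ := hs₀ s₀ le_rfl
    refine .inl ?_
    rw [← hF, ← hoF, expand, Finset.sum_eq_zero, add_zero]
    intro p _
    rw [pderivation_coordinate_of_ne fun h => ho ⟨p, h.symm⟩, mul_zero]

theorem coe_derivWord_pderivation (l : List (EdgeType d)) (F : nonlinearities d) :
    (derivWord pderivation l F : JetFun d) = pderivs l F := by
  induction l with
  | nil => rfl
  | cons o l ih => rw [derivWord_cons, coe_pderivation, ih]; rfl

theorem exists_word_coe_derivWord_shiftDerivation (k : Fin d → ℕ) :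
    ∃ w : List (Fin d), (∀ i, w.count i = k i) ∧
      ∀ F : nonlinearities d, (derivWord shiftDerivation w F : JetFun d) = shiftDerivs k F := by
  refine ⟨(List.finRange d).flatMap fun i => List.replicate (k i) i, fun i => ?_, fun F => ?_⟩
  · simp [List.count_flatMap, List.count_replicate, Function.comp_def, ← List.ofFn_eq_map,
      List.sum_ofFn]
  · rw [shiftDerivs]
    induction List.finRange d with
    | nil => rfl
    | cons i L ih =>
      rw [List.flatMap_cons, derivWord_append, List.foldr_cons, ← ih]
      generalize derivWord shiftDerivation _ F = G
      induction k i with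
      | zero => rfl
      | succ n ihn =>
        rw [List.replicate_succ, derivWord_cons, coe_shiftDerivation, ihn,
          Function.iterate_succ_apply']

theorem IsNonlinearity.pderivs {F : JetFun d} (hF : IsNonlinearity F) (l : List (EdgeType d)) :
    IsNonlinearity (pderivs l F) :=
  coe_derivWord_pderivation l ⟨F, hF⟩ ▸ Subtype.property _

theorem IsNonlinearity.shiftDerivs {F : JetFun d} (hF : IsNonlinearity F) (k : Fin d → ℕ) :
    IsNonlinearity (shiftDerivs k F) :=
  let ⟨_, _, hw⟩ := exists_word_coe_derivWord_shiftDerivation k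
  hw ⟨F, hF⟩ ▸ Subtype.property _

theorem IsNonlinearity.pderivs_congr {F : JetFun d} (hF : IsNonlinearity F)
    {l l' : List (EdgeType d)} (h : (l : Multiset (EdgeType d)) = l') :
    RegTrees.pderivs l F = RegTrees.pderivs l' F := by
  rw [← coe_derivWord_pderivation l ⟨F, hF⟩, ← coe_derivWord_pderivation l' ⟨F, hF⟩,
    derivWord_eq_of_perm pderivation_comm (Multiset.coe_eq_coe.mp h)]

theorem shiftDerivs_zero (k : Fin d → ℕ) : shiftDerivs k (0 : JetFun d) = 0 := by
  obtain ⟨w, -, hw⟩ := exists_word_coe_derivWord_shiftDerivation k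
  simpa using (hw 0).symm

theorem pderivs_zero (l : List (EdgeType d)) : pderivs l (0 : JetFun d) = 0 := by
  simpa using (coe_derivWord_pderivation l 0).symm

/-- Commuting `D_o` to the right past `∂^w` replaces it by `D_{(o.1, o.2 - e)}`, at the cost of
the letters of `w` counted by `e`. -/
theorem exists_lower_of_pderivation_derivWord_ne_zero {M : Type*} [AddCommMonoid M] [Module ℝ M]
    (L : nonlinearities d →ₗ[ℝ] M) {o : EdgeType d} {w : List (Fin d)} {G : nonlinearities d}
    (h : L (pderivation o (derivWord shiftDerivation w G)) ≠ 0) :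
    ∃ (w' : List (Fin d)) (e : Fin d → ℕ), e ≤ o.2 ∧ (∀ i, w'.count i + e i = w.count i) ∧
      L (derivWord shiftDerivation w' (pderivation (o.1, o.2 - e) G)) ≠ 0 := by
  induction w generalizing L o with
  | nil => exact ⟨[], 0, fun _ => Nat.zero_le _, by simp, by simpa using h⟩
  | cons i w ih =>
    set H := derivWord shiftDerivation w G with hH
    have commuted (h : L (shiftDerivation i (pderivation o H)) ≠ 0) : ∃ w' e, e ≤ o.2 ∧
        (∀ j, w'.count j + e j = (i :: w).count j) ∧
        L (derivWord shiftDerivation w' (pderivation (o.1, o.2 - e) G)) ≠ 0 := by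
      obtain ⟨w', e, he, hcount, hne⟩ := ih (L ∘ₗ (shiftDerivation i).toLinearMap) h
      refine ⟨i :: w', e, he, fun j => ?_, hne⟩
      rw [List.count_cons, List.count_cons, add_right_comm, hcount]
    rw [derivWord_cons, ← hH] at h
    obtain hcomm | ⟨q, rfl, hcomm⟩ := pderivation_shiftDerivation o i H
    · exact commuted (hcomm ▸ h)
    rw [hcomm, map_add] at h
    by_cases h' : L (shiftDerivation i (pderivation (EdgeKind.kernel, q + Pi.single i 1) H)) = 0
    · rw [h', zero_add] at h
      obtain ⟨w', e, he, hcount, hne⟩ := ih L h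
      refine ⟨w', e + Pi.single i 1, add_le_add_left he _, fun j => ?_, ?_⟩
      · rw [List.count_cons, ← hcount, Pi.add_apply, ← add_assoc, Pi.single_apply]
        simp only [beq_iff_eq, @eq_comm _ j i]
      · rwa [add_tsub_add_eq_tsub_right]
    · exact commuted h'

theorem exists_lower_of_derivWord_derivWord_ne_zero {ι : Type*}
    (t : ι → EdgeType d) {l : List ι} (hl : l.Nodup) {w : List (Fin d)} {G : nonlinearities d}
    (h : derivWord (fun v => pderivation (t v)) l (derivWord shiftDerivation w G) ≠ 0) :
    ∃ e : ι → Fin d → ℕ, (∀ v, e v ≤ (t v).2) ∧ (∀ i, (l.map e).sum i ≤ w.count i) ∧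
      derivWord (fun v => pderivation ((t v).1, (t v).2 - e v)) l G ≠ 0 := by
  classical
  induction l using List.reverseRecOn generalizing w G with
  | nil => exact ⟨0, fun _ _ => Nat.zero_le _, by simp, fun hG => h (by simp_all)⟩
  | append_singleton l v ih =>
    obtain ⟨hl, -, hv⟩ := List.nodup_append'.mp hl
    replace hv : v ∉ l := by simpa using hv
    rw [derivWord_append, derivWord_cons, derivWord_nil] at h
    obtain ⟨w', e₁, he₁, hcount, h⟩ := exists_lower_of_pderivation_derivWord_ne_zero _ h
    obtain ⟨e, he, hsum, h⟩ := ih hl h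
    have update_e : ∀ u ∈ l, Function.update e v e₁ u = e u := fun u hu =>
      Function.update_of_ne (ne_of_mem_of_not_mem hu hv) _ _
    refine ⟨Function.update e v e₁, fun u => ?_, fun i => ?_, ?_⟩
    · obtain rfl | hu := eq_or_ne u v
      · simpa using he₁
      · simpa [hu] using he u
    · simpa [List.map_congr_left update_e, ← hcount i] using hsum i
    · rw [derivWord_append, derivWord_cons, derivWord_nil, Function.update_self,
        derivWord_congr fun u hu => by rw [update_e u hu]]
      exact h

theorem exists_lower_of_pderivs_shiftDerivs_ne_zero {ι : Type*} {F : JetFun d}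
    (hF : IsNonlinearity F) {k : Fin d → ℕ} {E : List (EdgeType d)} (t : ι → EdgeType d)
    {l : List ι} (hl : l.Nodup) (h : pderivs (l.map t) (shiftDerivs k (pderivs E F)) ≠ 0) :
    ∃ e : ι → Fin d → ℕ, (∀ v, e v ≤ (t v).2) ∧ (l.map e).sum ≤ k ∧
      pderivs ((l.map fun v => ((t v).1, (t v).2 - e v)) ++ E) F ≠ 0 := by
  classical
  obtain ⟨w, hw, hshift⟩ := exists_word_coe_derivWord_shiftDerivation k
  lift F to nonlinearities d using hF
  rw [← coe_derivWord_pderivation E, ← hshift, ← coe_derivWord_pderivation, ← derivWord_comp] at h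
  obtain ⟨e, he, hsum, hne⟩ :=
    exists_lower_of_derivWord_derivWord_ne_zero t hl fun h' => h (by rw [h']; rfl)
  refine ⟨e, he, fun i => hw i ▸ hsum i, fun h' => hne (Subtype.ext ?_)⟩
  rw [derivWord_comp, ← derivWord_append, coe_derivWord_pderivation, h']
  rfl

open Classical in
theorem exists_upsilon_eq_coe_prod {FF : ℝ → JetFun d} (hFF : ∀ a, IsNonlinearity (FF a))
    (σ : DecTree d) : ∃ f : σ.Node → nonlinearities d,
      (∀ y, (f y : JetFun d) =
        shiftDerivs (σ.poly y) (pderivs (σ.outEdges y).toList (FF (σ.ext y)))) ∧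
      upsilon FF σ = (∏ y with ¬ σ.IsNoiseNode y, f y : nonlinearities d) :=
  ⟨fun y => ⟨_, ((hFF (σ.ext y)).pderivs _).shiftDerivs _⟩, fun _ => rfl, by
    rw [SubmonoidClass.coe_finsetProd, upsilon]⟩

theorem isNonlinearity_upsilon {FF : ℝ → JetFun d} (hFF : ∀ a, IsNonlinearity (FF a))
    (σ : DecTree d) : IsNonlinearity (upsilon FF σ) :=
  let ⟨_, _, h⟩ := exists_upsilon_eq_coe_prod hFF σ
  h ▸ Subtype.property _

theorem exists_assignment_of_pderivs_upsilon_ne_zero {ι : Type*} {FF : ℝ → JetFun d}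
    (hFF : ∀ a, IsNonlinearity (FF a)) {σ : DecTree d} {l : List ι} (hl : l.Nodup)
    {t : ι → EdgeType d} (h : pderivs (l.map t) (upsilon FF σ) ≠ 0) :
    ∃ a : ι → σ.Node, (∀ v ∈ l, ¬ σ.IsNoiseNode (a v)) ∧ ∀ y, ¬ σ.IsNoiseNode y →
      pderivs ((l.filter fun v => a v = y).map t)
        (shiftDerivs (σ.poly y) (pderivs (σ.outEdges y).toList (FF (σ.ext y)))) ≠ 0 := by
  classical
  obtain ⟨f, hf, hupsilon⟩ := exists_upsilon_eq_coe_prod hFF σ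
  rw [hupsilon, ← coe_derivWord_pderivation, ← derivWord_comp] at h
  have : Nonempty σ.Node := ⟨σ.root⟩
  obtain ⟨a, ha, hprod⟩ := exists_assignment_of_derivWord_prod_ne_zero _ hl
    fun h' => h (by rw [h']; rfl)
  refine ⟨a, fun v hv => (Finset.mem_filter.mp (ha v hv)).2, fun y hy h' => hprod ?_⟩
  refine Finset.prod_eq_zero (Finset.mem_filter.mpr ⟨Finset.mem_univ y, hy⟩) (Subtype.ext ?_)
  rw [derivWord_comp, coe_derivWord_pderivation, hf, h']
  rfl

/-- An attachment of the edges indexed by `s`, with types `t v`, to the nodes of `σ`. It describes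
one term in the expansion of `(∏_{v ∈ s} D_{t v}) Υ[σ]`: the derivative `D_{t v}` acts on the factor
of the node `node v` and is lowered by `lower v` by the operator `∂^{σ.poly}` of this node. -/
structure Attachment {ι : Type*} (σ : DecTree d) (s : Finset ι) (t : ι → EdgeType d) where
  node : ι → σ.Node
  lower : ι → Fin d → ℕ
  not_isNoiseNode : ∀ v ∈ s, ¬ σ.IsNoiseNode (node v)
  lower_le : ∀ v ∈ s, lower v ≤ (t v).2
  sum_lower_le : ∀ y, ∑ v ∈ s with node v = y, lower v ≤ σ.poly y

namespace Attachment

variable {ι : Type*} {σ : DecTree d} {s : Finset ι} {t : ι → EdgeType d}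

/-- The types of the edges that leave the node `y` after the attachment. -/
noncomputable def edgesAt (α : Attachment σ s t) (y : σ.Node) : Multiset (EdgeType d) :=
  σ.outEdges y + ({v ∈ s | α.node v = y} : Finset ι).val.map
    fun v => ((t v).1, (t v).2 - α.lower v)

end Attachment

theorem exists_attachment_of_pderivs_upsilon_ne_zero {ι : Type*} {FF : ℝ → JetFun d}
    (hFF : ∀ a, IsNonlinearity (FF a)) {σ : DecTree d} {s : Finset ι} {t : ι → EdgeType d}
    {E : List (EdgeType d)} (hE : (E : Multiset (EdgeType d)) = s.val.map t)
    (h : pderivs E (upsilon FF σ) ≠ 0) :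
    ∃ α : Attachment σ s t, ∀ y, ¬ σ.IsNoiseNode y →
      pderivs (α.edgesAt y).toList (FF (σ.ext y)) ≠ 0 := by
  classical
  rw [(isNonlinearity_upsilon hFF σ).pderivs_congr (l' := s.toList.map t)
    (by rw [hE, ← Multiset.map_coe, Finset.coe_toList])] at h
  obtain ⟨a, ha, hne⟩ := exists_assignment_of_pderivs_upsilon_ne_zero hFF s.nodup_toList h
  choose! e he hsum hne using fun y (hy : ¬ σ.IsNoiseNode y) =>
    exists_lower_of_pderivs_shiftDerivs_ne_zero (hFF _) t (s.nodup_toList.filter _) (hne y hy)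
  simp only [Finset.mem_toList] at ha
  have coe_filter (y : σ.Node) : ((s.toList.filter fun v => a v = y : List ι) : Multiset ι) =
      ({v ∈ s | a v = y} : Finset ι).val := by
    rw [← Multiset.filter_coe, Finset.coe_toList, Finset.filter_val]
  refine ⟨⟨a, fun v => e (a v) v, ha, fun v hv => he _ (ha v hv) v, fun y => ?_⟩,
    fun y hy => ?_⟩
  · by_cases hy : σ.IsNoiseNode y
    · rw [Finset.sum_eq_zero]
      · exact fun _ => Nat.zero_le _
      · intro v hv
        obtain ⟨hvs, rfl⟩ := Finset.mem_filter.mp hv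
        exact absurd hy (ha v hvs)
    · refine le_of_eq_of_le ?_ (hsum y hy)
      rw [← Multiset.sum_coe, ← Multiset.map_coe, coe_filter]
      change _ = ∑ v ∈ s with a v = y, e y v
      exact Finset.sum_congr rfl fun v hv => by rw [(Finset.mem_filter.mp hv).2]
  · rw [(hFF _).pderivs_congr]
    · exact hne y hy
    rw [Multiset.coe_toList, Attachment.edgesAt, ← Multiset.coe_add, Multiset.coe_toList,
      add_comm, ← Multiset.map_coe, coe_filter]
    congr 1
    refine Multiset.map_congr rfl fun v hv => ?_
    obtain ⟨-, rfl⟩ := Finset.mem_filter.mp hv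
    rfl

variable {δ : DegreeMap d} {R : Set (Multiset (EdgeType d))}

namespace DecTree

theorem mem_children {τ : DecTree d} {x v : τ.Node} :
    v ∈ τ.children x ↔ v ≠ τ.root ∧ τ.parent v = x := by
  simp [children]

theorem children_eq_empty_of_isNoiseNode {τ : DecTree d} {x : τ.Node} (h : τ.IsNoiseNode x) :
    τ.children x = ∅ :=
  Finset.eq_empty_iff_forall_notMem.mpr fun v hv =>
    (τ.noise_leaf x h.1 h.2).1 v (mem_children.mp hv).1 (mem_children.mp hv).2

theorem not_isNoiseNode_root (τ : DecTree d) : ¬ τ.IsNoiseNode τ.root :=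
  fun h => h.1 rfl

theorem induction {τ : DecTree d} {p : τ.Node → Prop} (root : p τ.root)
    (step : ∀ v, v ≠ τ.root → p (τ.parent v) → p v) (v : τ.Node) : p v := by
  obtain ⟨k, hk⟩ := τ.reaches_root v
  induction k generalizing v with
  | zero =>
    obtain rfl : v = τ.root := hk
    exact root
  | succ k ih =>
    obtain rfl | hv := eq_or_ne v τ.root
    · exact root
    · exact step v hv (ih _ hk)

theorem outEdges_apply_equiv {τ σ : DecTree d} (φ : τ.Node ≃ σ.Node) (hroot : φ τ.root = σ.root)
    (hparent : ∀ v, φ (τ.parent v) = σ.parent (φ v))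
    (hedge : ∀ v, v ≠ τ.root → σ.edge (φ v) = τ.edge v) (x : τ.Node) :
    σ.outEdges (φ x) = τ.outEdges x := by
  have hchildren : σ.children (φ x) = (τ.children x).map φ.toEmbedding := by
    ext v
    obtain ⟨v, rfl⟩ := φ.surjective v
    rw [Finset.mem_map_equiv, mem_children, mem_children, Equiv.symm_apply_apply, ← hparent,
      ← hroot, φ.injective.ne_iff, φ.apply_eq_iff_eq]
  rw [outEdges, hchildren, Finset.map_val, Multiset.map_map]
  exact Multiset.map_congr rfl fun v hv => hedge v (mem_children.mp hv).1

theorem Conforms.of_iso {τ σ : DecTree d} (hτ : τ.Conforms R) (h : τ.Iso σ) : σ.Conforms R := by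
  obtain ⟨φ, hroot, hparent, -, hext, hedge⟩ := h
  refine ⟨φ.surjective.forall.mpr fun x => ?_, φ.surjective.forall.mpr fun x => ?_⟩
  · rw [hext, hτ.1]
  · rw [outEdges_apply_equiv φ hroot hparent hedge]
    exact hτ.2 x

theorem Iso.degree_eq {τ σ : DecTree d} (h : τ.Iso σ) : τ.degree δ = σ.degree δ := by
  obtain ⟨φ, hroot, -, hpoly, -, hedge⟩ := h
  unfold degree
  congr 1
  · exact Fintype.sum_equiv φ _ _ fun v => by rw [hpoly]
  · refine Finset.sum_equiv φ (fun v => ?_) fun v hv => ?_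
    · simp [← hroot]
    · rw [hedge v (Finset.mem_filter.mp hv).2]

theorem degree_eq_zero_of_subsingleton {τ : DecTree d} [Subsingleton τ.Node]
    (h : τ.poly τ.root = 0) : τ.degree δ = 0 := by
  have hpoly (v : τ.Node) : τ.poly v = 0 := by rw [Subsingleton.elim v τ.root, h]
  have hedges : (Finset.univ.filter fun v => v ≠ τ.root) = ∅ :=
    Finset.filter_false_of_mem fun v _ hv => hv (Subsingleton.elim _ _)
  simp [degree, hpoly, hedges, DegreeMap.polyDeg]

end DecTree

theorem degree_neg_of_mem_negTrees {τ : DecTree d} (h : τ.toClass ∈ negTrees δ R) :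
    τ.degree δ < 0 := by
  obtain ⟨σ, hσ, -, hdeg, -⟩ := h
  rwa [← DecTree.Iso.degree_eq (Quotient.exact hσ)]

theorem mem_negTrees_of_mem_negExtTrees {τ : DecTree d} (hconf : τ.Conforms R)
    (h : τ.toClass ∈ negExtTrees δ R) : τ.toClass ∈ negTrees δ R := by
  obtain ⟨σ, hσ, -, hneg⟩ := h
  exact ⟨σ, hσ, hconf.of_iso (Quotient.exact hσ.symm), hneg⟩

/-! ### Extractions that contract a tree to a single node -/

namespace Extraction

variable {τ : DecTree d} (P : Extraction τ)

section AllEdges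

variable (hedges : ∀ v, v ≠ τ.root → v ∈ P.edges)
include hedges

theorem top_eq_root (v : τ.Node) : P.top v = τ.root :=
  by_contra fun hv => P.top_not_mem v (hedges _ hv)

theorem filter_top_eq_root (s : Finset τ.Node) : s.filter (fun v => P.top v = τ.root) = s :=
  Finset.filter_true_of_mem fun v _ => P.top_eq_root hedges v

theorem piE_eq_zero (v : τ.Node) : P.piE v = 0 :=
  Finset.sum_eq_zero fun w _ => P.eA_support w fun hw => hw.2.1 (hedges w hw.1)

theorem component_root_iso (hnA : ∀ v, P.nA v = τ.poly v) :
    (P.component τ.root P.root_not_mem).Iso τ := by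
  refine ⟨Equiv.subtypeUnivEquiv (P.top_eq_root hedges), rfl, fun v => ?_, fun v => ?_,
    fun _ => rfl, fun _ _ => rfl⟩
  · by_cases hv : v.1 ∈ P.edges
    · exact congrArg Subtype.val (dif_pos hv)
    · obtain hroot : v.1 = τ.root := by_contra fun h => hv (hedges _ h)
      refine (congrArg Subtype.val (dif_neg hv)).trans ?_
      change v.1 = τ.parent v.1
      rw [hroot, τ.parent_root]
  · change τ.poly v.1 = P.nA v.1 + P.piE v.1
    rw [hnA, P.piE_eq_zero hedges, add_zero]

theorem subsingleton_of_root_notMem_nodes (hroot : τ.root ∉ P.nodes) : Subsingleton τ.Node := by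
  have notMem_nodes : ∀ v, v ∉ P.nodes :=
    DecTree.induction hroot fun v hv ih _ => ih (P.edges_lower v (hedges v hv))
  exact subsingleton_of_forall_eq τ.root fun v => by_contra fun hv =>
    notMem_nodes v (P.edges_upper v (hedges v hv))

end AllEdges

section ContractsToUnit

variable {P} {a : ℝ} (h : (P.contract δ).Iso (DecTree.unit d a))
include h

theorem mem_edges_of_contract_iso_unit {v : τ.Node} (hv : v ≠ τ.root) : v ∈ P.edges := by
  obtain ⟨φ, -⟩ := h
  by_contra hve
  have heq : (⟨v, hve⟩ : {v // v ∉ P.edges}) = ⟨τ.root, P.root_not_mem⟩ :=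
    φ.injective (Subsingleton.elim (α := Unit) _ _)
  exact hv (congrArg Subtype.val heq)

theorem nA_eq_poly_of_contract_iso_unit (v : τ.Node) : P.nA v = τ.poly v := by
  have hedges := fun v => mem_edges_of_contract_iso_unit (v := v) h
  obtain ⟨φ, -, -, hpoly, -⟩ := h
  have hsum : ∑ v with P.top v = τ.root, (τ.poly v - P.nA v) = 0 :=
    (hpoly ⟨τ.root, P.root_not_mem⟩).symm
  rw [P.filter_top_eq_root hedges, Finset.sum_eq_zero_iff] at hsum
  exact (P.nA_le v).antisymm (tsub_eq_zero_iff_le.mp (hsum v (Finset.mem_univ v)))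

theorem sum_ext_add_degree_of_contract_iso_unit : ∑ v, τ.ext v + τ.degree δ = a := by
  have hedges := fun v => mem_edges_of_contract_iso_unit (v := v) h
  have hnA := nA_eq_poly_of_contract_iso_unit h
  obtain ⟨φ, -, -, -, hext, -⟩ := h
  have hsum : ∑ v with P.top v = τ.root, (τ.ext v + δ.polyDeg (P.nA v + P.piE v)) +
      ∑ v ∈ P.edges with P.top v = τ.root, δ.edgeDeg (τ.edge v) = a :=
    (hext ⟨τ.root, P.root_not_mem⟩).symm
  have edges_eq : P.edges = Finset.univ.filter (fun v => v ≠ τ.root) := by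
    ext v
    simpa using ⟨P.edges_ne_root v, hedges v⟩
  rw [P.filter_top_eq_root hedges, P.filter_top_eq_root hedges, Finset.sum_add_distrib, add_assoc,
    edges_eq] at hsum
  simpa only [DecTree.degree, hnA, P.piE_eq_zero hedges, add_zero] using hsum

theorem mem_forest_or_subsingleton_of_contract_iso_unit :
    τ.toClass ∈ P.forest ∨ (Subsingleton τ.Node ∧ τ.poly τ.root = 0) := by
  have hedges := fun v => mem_edges_of_contract_iso_unit (v := v) h
  have hnA := nA_eq_poly_of_contract_iso_unit h
  by_cases hroot : τ.root ∈ P.nodes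
  · exact Or.inl (Multiset.mem_map.mpr ⟨⟨τ.root, hroot, P.root_not_mem⟩, Finset.mem_univ _,
      Quotient.sound (P.component_root_iso hedges hnA)⟩)
  · exact Or.inr ⟨P.subsingleton_of_root_notMem_nodes hedges hroot,
      by rw [← hnA, P.nA_support _ hroot]⟩

end ContractsToUnit

end Extraction

theorem exists_extraction_of_renorm_apply_ne_zero {g : NegChar δ R} {c b : TreeClass d}
    (h : renorm g (Finsupp.single c 1) b ≠ 0) :
    ∃ P : Extraction (Quotient.out c : DecTree d), P.forest ∈ negForests δ R ∧
      (P.contract δ).toClass = b := by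
  contrapose! h
  have renorm_single : renorm g (Finsupp.single c 1) = TensorProduct.lid ℝ (TreeSpace d)
      (LinearMap.rTensor (TreeSpace d) g.toLinearMap
        (coactTree δ R (Quotient.out c : DecTree d))) := by
    simp [renorm, coaction]
  rw [renorm_single, coactTree]
  refine finsum_induction (fun z => (TensorProduct.lid ℝ (TreeSpace d)
    (LinearMap.rTensor (TreeSpace d) g.toLinearMap z)) b = 0) ?_ ?_ fun P => ?_
  · simp
  · intro x y hx hy
    rw [map_add, map_add, Finsupp.add_apply, hx, hy, add_zero]
  · by_cases hP : P.forest ∈ negForests δ R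
    · simp [h P hP]
    · simp [projNeg, hP]

theorem renorm_apply_ne_zero_of_renormAdj_ne_zero {g : NegChar δ R} {b c : TreeClass d}
    (h : renormAdj g (Finsupp.single b 1) c ≠ 0) : renorm g (Finsupp.single c 1) b ≠ 0 := by
  contrapose! h
  unfold renormAdj treeInner
  rw [Finsupp.sum_single_index (by simp), h]
  simp

/-! ### Expansions of single nodes -/

theorem isNonlinearity_reduced {F : JetFun d} (hF : IsNonlinearity F) (a : ℝ) :
    IsNonlinearity (reduced F a) := by
  obtain rfl | ha := eq_or_ne a 0
  · rwa [reduced, Pi.single_eq_same]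
  · rw [reduced, Pi.single_eq_of_ne ha]
    exact (nonlinearities d).zero_mem

theorem exists_of_pderivs_upsilonLin_ne_zero {FF : ℝ → JetFun d}
    (hFF : ∀ a, IsNonlinearity (FF a)) {u : TreeClass d → ℝ} {E : List (EdgeType d)}
    (h : pderivs E (upsilonLin FF u) ≠ 0) :
    ∃ c, u c ≠ 0 ∧ pderivs E (upsilon FF (Quotient.out c)) ≠ 0 := by
  contrapose! h
  obtain ⟨G, hG, hzero⟩ : ∃ G : nonlinearities d, (G : JetFun d) = upsilonLin FF u ∧
      derivWord pderivation E G = 0 := by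
    refine finsum_induction (fun f => ∃ G : nonlinearities d, (G : JetFun d) = f ∧
      derivWord pderivation E G = 0) ⟨0, rfl, map_zero _⟩ ?_ fun c => ?_
    · rintro _ _ ⟨G, rfl, hG⟩ ⟨H, rfl, hH⟩
      exact ⟨G + H, rfl, by rw [map_add, hG, hH, add_zero]⟩
    · refine ⟨u c • ⟨_, isNonlinearity_upsilon hFF (Quotient.out c)⟩, rfl, ?_⟩
      obtain hc | hc := eq_or_ne (u c) 0
      · rw [hc, zero_smul, map_zero]
      · rw [map_smul, smul_eq_zero]
        exact Or.inr (Subtype.ext ((coe_derivWord_pderivation _ _).trans (h c hc)))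
  rw [← hG, ← coe_derivWord_pderivation, hzero]
  rfl

theorem exists_extraction_of_pderivs_act_ne_zero {FF : ℝ → JetFun d}
    (hFF : ∀ a, IsNonlinearity (FF a)) {g : NegChar δ R} {a : ℝ} {E : List (EdgeType d)}
    (h : pderivs E (act FF g a) ≠ 0) :
    ∃ (σ : DecTree d) (P : Extraction σ), P.forest ∈ negForests δ R ∧
      (P.contract δ).Iso (DecTree.unit d a) ∧ pderivs E (upsilon FF σ) ≠ 0 := by
  obtain ⟨c, hc, hne⟩ := exists_of_pderivs_upsilonLin_ne_zero hFF h
  obtain ⟨P, hforest, hP⟩ :=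
    exists_extraction_of_renorm_apply_ne_zero (renorm_apply_ne_zero_of_renormAdj_ne_zero hc)
  exact ⟨_, P, hforest, Quotient.exact hP, hne⟩

theorem pderivs_toList_ne_zero_of_upsilon_ne_zero {FF : ℝ → JetFun d} {τ : DecTree d}
    (h : upsilon FF τ ≠ 0) {x : τ.Node} (hx : ¬ τ.IsNoiseNode x) :
    pderivs (τ.outEdges x).toList (FF (τ.ext x)) ≠ 0 := by
  classical
  contrapose! h
  refine Finset.prod_eq_zero (i := x) (Finset.mem_filter.mpr ⟨Finset.mem_univ x, hx⟩) ?_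
  rw [h, shiftDerivs_zero]

theorem ext_eq_zero_of_upsilon_reduced_ne_zero {F : JetFun d} {σ : DecTree d}
    (h : upsilon (reduced F) σ ≠ 0) (y : σ.Node) : σ.ext y = 0 := by
  by_cases hy : σ.IsNoiseNode y
  · exact (σ.noise_leaf y hy.1 hy.2).2.2
  by_contra hext
  refine pderivs_toList_ne_zero_of_upsilon_ne_zero h hy ?_
  rw [reduced, Pi.single_eq_of_ne hext, pderivs_zero]

/-- A tree that is contracted to the node `x` of `τ`, with an attachment of the edges leaving `x`:
either a negative tree that is extracted, or a single node. -/
structure NodeExpansion (δ : DegreeMap d) (R : Set (Multiset (EdgeType d))) (τ : DecTree d)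
    (x : τ.Node) where
  tree : DecTree d
  attachment : Attachment tree (τ.children x) τ.edge
  ext_eq_zero : ∀ y, tree.ext y = 0
  edgesAt_mem : ∀ y, attachment.edgesAt y ∈ R
  degree_eq : tree.degree δ = τ.ext x
  negative_or_trivial : tree.toClass ∈ negTrees δ R ∨
    (Subsingleton tree.Node ∧ tree.poly tree.root = 0)

theorem Attachment.edgesAt_eq_zero_of_isNoiseNode {ι : Type*} {σ : DecTree d} {s : Finset ι}
    {t : ι → EdgeType d} (α : Attachment σ s t) {y : σ.Node} (hy : σ.IsNoiseNode y) :
    α.edgesAt y = 0 := by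
  have hnode : ({v ∈ s | α.node v = y} : Finset ι) = ∅ :=
    Finset.filter_false_of_mem fun v hv h => α.not_isNoiseNode v hv (h ▸ hy)
  rw [edgesAt, hnode, DecTree.outEdges, DecTree.children_eq_empty_of_isNoiseNode hy]
  rfl

theorem nonempty_nodeExpansion (hR : IsNormal R) {F : JetFun d} (hF : IsNonlinearity F)
    (hobey : Obeys F R) {g : NegChar δ R} {τ : DecTree d} {x : τ.Node} {E : List (EdgeType d)}
    (hE : (E : Multiset (EdgeType d)) = τ.outEdges x)
    (h : pderivs E (act (reduced F) g (τ.ext x)) ≠ 0) : Nonempty (NodeExpansion δ R τ x) := by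
  have hred := isNonlinearity_reduced hF
  obtain ⟨σ, P, hforest, hiso, hne⟩ := exists_extraction_of_pderivs_act_ne_zero hred h
  have hext := ext_eq_zero_of_upsilon_reduced_ne_zero fun h0 => hne (h0 ▸ pderivs_zero E)
  obtain ⟨α, hα⟩ := exists_attachment_of_pderivs_upsilon_ne_zero hred hE hne
  have mem_of_not_noise (y : σ.Node) (hy : ¬ σ.IsNoiseNode y) : α.edgesAt y ∈ R := by
    have hy' := hα y hy
    rw [hext, reduced, Pi.single_eq_same] at hy'
    simpa using not_imp_comm.mp (hobey _) hy'
  have edgesAt_mem (y : σ.Node) : α.edgesAt y ∈ R := by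
    by_cases hy : σ.IsNoiseNode y
    · rw [α.edgesAt_eq_zero_of_isNoiseNode hy]
      exact hR _ _ (Multiset.zero_le _) (mem_of_not_noise _ σ.not_isNoiseNode_root)
    · exact mem_of_not_noise y hy
  have hconf : σ.Conforms R :=
    ⟨hext, fun y => hR _ _ (Multiset.le_add_right _ _) (edgesAt_mem y)⟩
  exact ⟨{
    tree := σ
    attachment := α
    ext_eq_zero := hext
    edgesAt_mem := edgesAt_mem
    degree_eq := by
      simpa [hext] using Extraction.sum_ext_add_degree_of_contract_iso_unit hiso
    negative_or_trivial :=
      (Extraction.mem_forest_or_subsingleton_of_contract_iso_unit hiso).imp_left fun hmem =>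
        mem_negTrees_of_mem_negExtTrees hconf (hforest _ hmem) }⟩

/-! ### Gluing expansions of nodes -/

namespace Attachment

variable {ι : Type*} {σ : DecTree d} {s : Finset ι} {t : ι → EdgeType d} (α : Attachment σ s t)

/-- The part of the polynomial decoration that has not been used to lower the attached edges. -/
noncomputable def rest (y : σ.Node) : Fin d → ℕ :=
  σ.poly y - ∑ v ∈ s with α.node v = y, α.lower v

theorem rest_le (y : σ.Node) : α.rest y ≤ σ.poly y :=
  tsub_le_self

theorem rest_add_sum_lower (y : σ.Node) :
    α.rest y + ∑ v ∈ s with α.node v = y, α.lower v = σ.poly y :=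
  tsub_add_cancel_of_le (α.sum_lower_le y)

end Attachment

namespace NodeExpansion

variable {τ : DecTree d} {x : τ.Node} (Λ : NodeExpansion δ R τ x)

/-- The case in which the tree contracted to the node is a negative tree. -/
def IsNegative : Prop :=
  Λ.tree.toClass ∈ negTrees δ R

theorem not_isNegative_of_ext_eq_zero (hx : τ.ext x = 0) : ¬ Λ.IsNegative := fun h =>
  (degree_neg_of_mem_negTrees h).ne (Λ.degree_eq.trans hx)

section NotNegative

variable {Λ} (hΛ : ¬ Λ.IsNegative)
include hΛ

theorem subsingleton : Subsingleton Λ.tree.Node :=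
  (Λ.negative_or_trivial.resolve_left hΛ).1

theorem poly_eq_zero (y : Λ.tree.Node) : Λ.tree.poly y = 0 := by
  have := subsingleton hΛ
  rw [Subsingleton.elim y Λ.tree.root, (Λ.negative_or_trivial.resolve_left hΛ).2]

theorem rest_eq_zero (y : Λ.tree.Node) : Λ.attachment.rest y = 0 :=
  nonpos_iff_eq_zero.mp (poly_eq_zero hΛ y ▸ Λ.attachment.rest_le y)

theorem lower_eq_zero {v : τ.Node} (hv : v ∈ τ.children x) : Λ.attachment.lower v = 0 := by
  have hsum := Λ.attachment.rest_add_sum_lower (Λ.attachment.node v)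
  rw [poly_eq_zero hΛ, rest_eq_zero hΛ, zero_add] at hsum
  exact Finset.sum_eq_zero_iff.mp hsum v (Finset.mem_filter.mpr ⟨hv, rfl⟩)

end NotNegative

end NodeExpansion

/-- An expansion of every node of `τ`, from which a conforming tree is glued that contracts
to `τ`. -/
abbrev Expansion (δ : DegreeMap d) (R : Set (Multiset (EdgeType d))) (τ : DecTree d) : Type 1 :=
  ∀ x, NodeExpansion δ R τ x

namespace Expansion

variable {τ : DecTree d} (Γ : Expansion δ R τ)

/-- The nodes of the glued tree. -/
abbrev GluedNode : Type := Σ x : τ.Node, (Γ x).tree.Node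

/-- The root of the tree that expands `x`. It is the upper end of the glued edge `(parent x, x)`. -/
def base (x : τ.Node) : Γ.GluedNode := ⟨x, (Γ x).tree.root⟩

theorem base_injective : Function.Injective Γ.base := fun _ _ h => (Sigma.mk.inj h).1

theorem mk_ne_base {x x' : τ.Node} {y : (Γ x).tree.Node} (h : y ≠ (Γ x).tree.root) :
    (⟨x, y⟩ : Γ.GluedNode) ≠ Γ.base x' := by
  intro heq
  obtain ⟨rfl, hy⟩ := Sigma.mk.inj heq
  exact h (eq_of_heq hy)

open Classical in
/-- The parents of the glued tree. -/
noncomputable def gluedParent (p : Γ.GluedNode) : Γ.GluedNode :=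
  if p.2 = (Γ p.1).tree.root then
    if p.1 = τ.root then p else ⟨τ.parent p.1, (Γ (τ.parent p.1)).attachment.node p.1⟩
  else ⟨p.1, (Γ p.1).tree.parent p.2⟩

theorem gluedParent_mk {x : τ.Node} {y : (Γ x).tree.Node} (h : y ≠ (Γ x).tree.root) :
    Γ.gluedParent ⟨x, y⟩ = ⟨x, (Γ x).tree.parent y⟩ := by
  simp [gluedParent, h]

theorem gluedParent_base {x : τ.Node} (h : x ≠ τ.root) :
    Γ.gluedParent (Γ.base x) = ⟨τ.parent x, (Γ (τ.parent x)).attachment.node x⟩ := by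
  simp [gluedParent, base, h]

theorem gluedParent_base_root : Γ.gluedParent (Γ.base τ.root) = Γ.base τ.root := by
  simp [gluedParent, base]

theorem exists_iterate_gluedParent_eq (p : Γ.GluedNode) :
    ∃ k : ℕ, Γ.gluedParent^[k] p = Γ.base τ.root := by
  have of_parent (p : Γ.GluedNode) :
      (∃ k, Γ.gluedParent^[k] (Γ.gluedParent p) = Γ.base τ.root) →
        ∃ k, Γ.gluedParent^[k] p = Γ.base τ.root :=
    fun ⟨k, hk⟩ => ⟨k + 1, hk⟩
  have of_base (x : τ.Node) (hx : ∃ k, Γ.gluedParent^[k] (Γ.base x) = Γ.base τ.root) :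
      ∀ y, ∃ k, Γ.gluedParent^[k] ⟨x, y⟩ = Γ.base τ.root :=
    DecTree.induction hx fun y hy ih => of_parent _ (by rwa [Γ.gluedParent_mk hy])
  have reaches : ∀ x y, ∃ k, Γ.gluedParent^[k] ⟨x, y⟩ = Γ.base τ.root :=
    DecTree.induction (of_base _ ⟨0, rfl⟩) fun x hx ih =>
      of_base x (of_parent _ (by rw [Γ.gluedParent_base hx]; exact ih _))
  exact reaches p.1 p.2

theorem ne_base_root_and_gluedParent_eq_iff {p : Γ.GluedNode} {x : τ.Node}
    {y : (Γ x).tree.Node} :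
    (p ≠ Γ.base τ.root ∧ Γ.gluedParent p = ⟨x, y⟩) ↔
      (∃ z ∈ (Γ x).tree.children y, ⟨x, z⟩ = p) ∨
      ∃ v ∈ τ.children x, (Γ x).attachment.node v = y ∧ Γ.base v = p := by
  constructor
  · rintro ⟨hp, h⟩
    obtain ⟨x', z⟩ := p
    obtain rfl | hz := eq_or_ne z (Γ x').tree.root
    · change Γ.base x' ≠ _ at hp
      change Γ.gluedParent (Γ.base x') = _ at h
      have hx' : x' ≠ τ.root := fun hx' => hp (congrArg Γ.base hx')
      rw [Γ.gluedParent_base hx'] at h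
      obtain ⟨rfl, hy⟩ := Sigma.mk.inj h
      exact Or.inr ⟨x', DecTree.mem_children.mpr ⟨hx', rfl⟩, eq_of_heq hy, rfl⟩
    · rw [Γ.gluedParent_mk hz] at h
      obtain ⟨rfl, hy⟩ := Sigma.mk.inj h
      exact Or.inl ⟨z, DecTree.mem_children.mpr ⟨hz, eq_of_heq hy⟩, rfl⟩
  · rintro (⟨z, hz, rfl⟩ | ⟨v, hv, rfl, rfl⟩)
    · obtain ⟨hz, hparent⟩ := DecTree.mem_children.mp hz
      exact ⟨Γ.mk_ne_base hz, by rw [Γ.gluedParent_mk hz, hparent]⟩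
    · obtain ⟨hne, rfl⟩ := DecTree.mem_children.mp hv
      exact ⟨fun h => hne (Γ.base_injective h), Γ.gluedParent_base hne⟩

open Classical in
/-- The edge decoration of the glued tree. -/
noncomputable def gluedEdge (p : Γ.GluedNode) : EdgeType d :=
  if p.2 = (Γ p.1).tree.root then
    ((τ.edge p.1).1, (τ.edge p.1).2 - (Γ (τ.parent p.1)).attachment.lower p.1)
  else (Γ p.1).tree.edge p.2

theorem gluedEdge_base (x : τ.Node) : Γ.gluedEdge (Γ.base x) =
    ((τ.edge x).1, (τ.edge x).2 - (Γ (τ.parent x)).attachment.lower x) := by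
  simp [gluedEdge, base]

theorem gluedEdge_mk {x : τ.Node} {y : (Γ x).tree.Node} (h : y ≠ (Γ x).tree.root) :
    Γ.gluedEdge ⟨x, y⟩ = (Γ x).tree.edge y := by
  simp [gluedEdge, h]

open Classical in
/-- The polynomial decoration of the glued tree. The decoration of `x` is put at the root of the
tree that expands `x`. -/
noncomputable def gluedPoly (p : Γ.GluedNode) : Fin d → ℕ :=
  (Γ p.1).attachment.rest p.2 + if p.2 = (Γ p.1).tree.root then τ.poly p.1 else 0

theorem gluedPoly_base (x : τ.Node) :
    Γ.gluedPoly (Γ.base x) = (Γ x).attachment.rest (Γ x).tree.root + τ.poly x := by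
  simp [gluedPoly, base]

theorem gluedPoly_mk {x : τ.Node} {y : (Γ x).tree.Node} (h : y ≠ (Γ x).tree.root) :
    Γ.gluedPoly ⟨x, y⟩ = (Γ x).attachment.rest y := by
  simp [gluedPoly, h]

theorem gluedParent_ne_of_isNoiseNode {x : τ.Node} (hx : τ.IsNoiseNode x) {p : Γ.GluedNode}
    (hp : p ≠ Γ.base τ.root) : Γ.gluedParent p ≠ Γ.base x := by
  intro h
  obtain ⟨z, hz, -⟩ | ⟨v, hv, -⟩ := Γ.ne_base_root_and_gluedParent_eq_iff.mp ⟨hp, h⟩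
  · have := NodeExpansion.subsingleton
      ((Γ x).not_isNegative_of_ext_eq_zero (τ.noise_leaf x hx.1 hx.2).2.2)
    exact (DecTree.mem_children.mp hz).1 (Subsingleton.elim _ _)
  · rw [DecTree.children_eq_empty_of_isNoiseNode hx] at hv
    exact Finset.notMem_empty v hv

theorem gluedParent_ne_of_tree_isNoiseNode {x : τ.Node} {y : (Γ x).tree.Node}
    (hy : (Γ x).tree.IsNoiseNode y) {p : Γ.GluedNode} (hp : p ≠ Γ.base τ.root) :
    Γ.gluedParent p ≠ ⟨x, y⟩ := by
  intro h
  obtain ⟨z, hz, -⟩ | ⟨v, hv, rfl, -⟩ := Γ.ne_base_root_and_gluedParent_eq_iff.mp ⟨hp, h⟩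
  · rw [DecTree.children_eq_empty_of_isNoiseNode hy] at hz
    exact Finset.notMem_empty z hz
  · exact (Γ x).attachment.not_isNoiseNode v hv hy

/-- The glued tree. -/
noncomputable def glue : DecTree d where
  Node := Γ.GluedNode
  fintypeNode := inferInstance
  root := Γ.base τ.root
  parent := Γ.gluedParent
  parent_root := Γ.gluedParent_base_root
  reaches_root := Γ.exists_iterate_gluedParent_eq
  poly := Γ.gluedPoly
  ext := fun _ => 0
  edge := Γ.gluedEdge
  noise_leaf := by
    rintro ⟨x, y⟩ hp hnoise
    obtain rfl | hy := eq_or_ne y (Γ x).tree.root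
    · change (Γ.gluedEdge (Γ.base x)).1 = _ at hnoise
      rw [gluedEdge_base] at hnoise
      have hx : τ.IsNoiseNode x := ⟨fun h => hp (congrArg Γ.base h), hnoise⟩
      obtain ⟨-, hpoly, hext⟩ := τ.noise_leaf x hx.1 hx.2
      refine ⟨fun q hq => Γ.gluedParent_ne_of_isNoiseNode hx hq, ?_, rfl⟩
      refine (Γ.gluedPoly_base x).trans ?_
      rw [hpoly, NodeExpansion.rest_eq_zero ((Γ x).not_isNegative_of_ext_eq_zero hext), add_zero]
    · rw [gluedEdge_mk _ hy] at hnoise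
      refine ⟨fun q hq => Γ.gluedParent_ne_of_tree_isNoiseNode ⟨hy, hnoise⟩ hq, ?_, rfl⟩
      rw [gluedPoly_mk _ hy]
      exact nonpos_iff_eq_zero.mp
        (((Γ x).attachment.rest_le y).trans_eq ((Γ x).tree.noise_leaf y hy hnoise).2.1)

/-- The inclusion of the tree that expands `x` into the glued tree. -/
def treeEmbedding (x : τ.Node) : (Γ x).tree.Node ↪ Γ.glue.Node :=
  ⟨fun y => (⟨x, y⟩ : Γ.GluedNode), fun _ _ h => eq_of_heq (Sigma.mk.inj h).2⟩

/-- The map that sends a node of `τ` to the root of its expansion. -/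
def baseEmbedding : τ.Node ↪ Γ.glue.Node :=
  ⟨Γ.base, Γ.base_injective⟩

theorem children_glue_val (x : τ.Node) (y : (Γ x).tree.Node) :
    (Γ.glue.children (Γ.treeEmbedding x y)).val =
      ((Γ x).tree.children y).val.map (Γ.treeEmbedding x) +
        ({v ∈ τ.children x | (Γ x).attachment.node v = y} : Finset τ.Node).val.map
          Γ.baseEmbedding := by
  have hdisj : Disjoint (((Γ x).tree.children y).map (Γ.treeEmbedding x))
      ({v ∈ τ.children x | (Γ x).attachment.node v = y}.map Γ.baseEmbedding) := by
    simp only [Finset.disjoint_left, Finset.mem_map]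
    rintro _ ⟨z, hz, rfl⟩ ⟨v, -, h⟩
    exact Γ.mk_ne_base (x' := v) (DecTree.mem_children.mp hz).1 h.symm
  rw [← Finset.map_val, ← Finset.map_val, ← Finset.disjUnion_val _ _ hdisj, Finset.val_inj]
  ext p
  simp only [Finset.mem_disjUnion, Finset.mem_map, Finset.mem_filter, and_assoc]
  exact DecTree.mem_children.trans Γ.ne_base_root_and_gluedParent_eq_iff

theorem outEdges_glue (x : τ.Node) (y : (Γ x).tree.Node) :
    Γ.glue.outEdges (Γ.treeEmbedding x y) = (Γ x).attachment.edgesAt y := by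
  rw [DecTree.outEdges, children_glue_val, Multiset.map_add, Multiset.map_map, Multiset.map_map]
  refine congrArg₂ (· + ·) (Multiset.map_congr rfl fun z hz => ?_)
    (Multiset.map_congr rfl fun v hv => ?_)
  · exact Γ.gluedEdge_mk (DecTree.mem_children.mp hz).1
  · obtain ⟨-, rfl⟩ := DecTree.mem_children.mp (Finset.mem_filter.mp hv).1
    exact Γ.gluedEdge_base v

theorem conforms_glue : Γ.glue.Conforms R := by
  refine ⟨fun _ => rfl, fun ⟨x, y⟩ => ?_⟩
  have hmem := (Γ x).edgesAt_mem y
  rwa [← Γ.outEdges_glue] at hmem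

open Classical in
/-- The extraction of all negative trees from the glued tree. -/
noncomputable def extraction : Extraction Γ.glue where
  nodes := Finset.univ.filter fun p : Γ.GluedNode => (Γ p.1).IsNegative
  edges := Finset.univ.filter fun p : Γ.GluedNode => p.2 ≠ (Γ p.1).tree.root
  edges_ne_root := fun _ h => Γ.mk_ne_base (Finset.mem_filter.mp h).2
  edges_upper := by
    rintro ⟨x, y⟩ h
    refine Finset.mem_filter.mpr ⟨Finset.mem_univ _, by_contra fun hΛ => ?_⟩
    have := NodeExpansion.subsingleton hΛ
    exact (Finset.mem_filter.mp h).2 (Subsingleton.elim _ _)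
  edges_lower := by
    rintro ⟨x, y⟩ h
    have hy : y ≠ (Γ x).tree.root := (Finset.mem_filter.mp h).2
    refine Finset.mem_filter.mpr ⟨Finset.mem_univ _, by_contra fun hΛ => hy ?_⟩
    rw [show Γ.glue.parent ⟨x, y⟩ = ⟨x, (Γ x).tree.parent y⟩ from Γ.gluedParent_mk hy] at hΛ
    have := NodeExpansion.subsingleton hΛ
    exact Subsingleton.elim _ _
  nA := fun p => (Γ p.1).attachment.rest p.2
  nA_le := fun p => le_self_add
  nA_support := fun p hp => NodeExpansion.rest_eq_zero
    (fun hΛ => hp (Finset.mem_filter.mpr ⟨Finset.mem_univ _, hΛ⟩)) p.2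
  eA := fun p => if p.2 = (Γ p.1).tree.root ∧ p.1 ≠ τ.root then
    (Γ (τ.parent p.1)).attachment.lower p.1 else 0
  eA_support := by
    rintro ⟨x, y⟩ h
    refine ite_eq_right_iff.mpr ?_
    rintro ⟨hy : y = (Γ x).tree.root, hx : x ≠ τ.root⟩
    subst hy
    have hparent : Γ.glue.parent ⟨x, (Γ x).tree.root⟩ = _ := Γ.gluedParent_base hx
    refine NodeExpansion.lower_eq_zero (fun hΛ => h ⟨fun heq => hx (Γ.base_injective heq),
      fun hmem => (Finset.mem_filter.mp hmem).2 rfl, ?_⟩) (DecTree.mem_children.mpr ⟨hx, rfl⟩)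
    rw [hparent]
    exact Finset.mem_filter.mpr ⟨Finset.mem_univ _, hΛ⟩

theorem treeEmbedding_mem_edges_iff {x : τ.Node} {y : (Γ x).tree.Node} :
    Γ.treeEmbedding x y ∈ Γ.extraction.edges ↔ y ≠ (Γ x).tree.root :=
  Finset.mem_filter.trans (and_iff_right (Finset.mem_univ _))

theorem baseEmbedding_notMem_edges (x : τ.Node) : Γ.baseEmbedding x ∉ Γ.extraction.edges :=
  fun h => Γ.treeEmbedding_mem_edges_iff.mp h rfl

theorem exists_baseEmbedding_eq_of_notMem_edges {p : Γ.glue.Node} (hp : p ∉ Γ.extraction.edges) :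
    ∃ x, Γ.baseEmbedding x = p := by
  obtain ⟨x, y⟩ := p
  obtain rfl : y = (Γ x).tree.root :=
    by_contra fun hy => hp (Γ.treeEmbedding_mem_edges_iff.mpr hy)
  exact ⟨x, rfl⟩

theorem top_treeEmbedding (x : τ.Node) :
    ∀ y, Γ.extraction.top (Γ.treeEmbedding x y) = Γ.baseEmbedding x := by
  refine DecTree.induction (Γ.extraction.top_of_not_mem (Γ.baseEmbedding_notMem_edges x))
    fun y hy ih => ?_
  rw [Γ.extraction.top_of_mem (Γ.treeEmbedding_mem_edges_iff.mpr hy), ← ih]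
  exact congrArg _ (Γ.gluedParent_mk hy)

theorem top_eq_baseEmbedding_iff {p : Γ.glue.Node} {x : τ.Node} :
    Γ.extraction.top p = Γ.baseEmbedding x ↔ ∃ y, Γ.treeEmbedding x y = p := by
  constructor
  · obtain ⟨x', y⟩ := p
    intro h
    obtain rfl := Γ.baseEmbedding.injective ((Γ.top_treeEmbedding x' y).symm.trans h)
    exact ⟨y, rfl⟩
  · rintro ⟨y, rfl⟩
    exact Γ.top_treeEmbedding x y

theorem filter_top_eq_baseEmbedding (x : τ.Node) :
    (Finset.univ.filter fun p => Γ.extraction.top p = Γ.baseEmbedding x) =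
      Finset.univ.map (Γ.treeEmbedding x) := by
  ext p
  simp [top_eq_baseEmbedding_iff]

theorem filter_edges_top_eq_baseEmbedding (x : τ.Node) :
    (Γ.extraction.edges.filter fun p => Γ.extraction.top p = Γ.baseEmbedding x) =
      (Finset.univ.filter fun y => y ≠ (Γ x).tree.root).map (Γ.treeEmbedding x) := by
  ext p
  simp only [Finset.mem_filter, Finset.mem_map, top_eq_baseEmbedding_iff, Finset.mem_univ,
    true_and]
  constructor
  · rintro ⟨h, y, rfl⟩
    exact ⟨y, Γ.treeEmbedding_mem_edges_iff.mp h, rfl⟩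
  · rintro ⟨y, hy, rfl⟩
    exact ⟨Γ.treeEmbedding_mem_edges_iff.mpr hy, y, rfl⟩

theorem eA_treeEmbedding {x : τ.Node} {y : (Γ x).tree.Node} (h : y ≠ (Γ x).tree.root) :
    Γ.extraction.eA (Γ.treeEmbedding x y) = 0 :=
  if_neg fun hy => h hy.1

theorem eA_baseEmbedding {x : τ.Node} (h : x ≠ τ.root) :
    Γ.extraction.eA (Γ.baseEmbedding x) = (Γ (τ.parent x)).attachment.lower x :=
  if_pos ⟨rfl, h⟩

theorem piE_treeEmbedding (x : τ.Node) (y : (Γ x).tree.Node) :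
    Γ.extraction.piE (Γ.treeEmbedding x y) =
      ∑ v ∈ τ.children x with (Γ x).attachment.node v = y, (Γ x).attachment.lower v := by
  have htree : ∀ z ∈ ((Γ x).tree.children y).val,
      Γ.extraction.eA (Γ.treeEmbedding x z) = 0 :=
    fun z hz => Γ.eA_treeEmbedding (DecTree.mem_children.mp hz).1
  have hbase : ∀ v ∈ ({v ∈ τ.children x | (Γ x).attachment.node v = y} : Finset τ.Node).val,
      Γ.extraction.eA (Γ.baseEmbedding v) = (Γ x).attachment.lower v := by
    intro v hv
    obtain ⟨hne, rfl⟩ := DecTree.mem_children.mp (Finset.mem_filter.mp hv).1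
    exact Γ.eA_baseEmbedding hne
  rw [Extraction.piE, Finset.sum_eq_multiset_sum, children_glue_val, Multiset.map_add,
    Multiset.map_map, Multiset.map_map, Multiset.sum_add]
  simp only [Function.comp_def, Multiset.map_congr rfl htree, Multiset.map_congr rfl hbase]
  rw [Multiset.map_const', Multiset.sum_replicate, smul_zero, zero_add]
  rfl

theorem nA_add_piE_treeEmbedding (x : τ.Node) (y : (Γ x).tree.Node) :
    Γ.extraction.nA (Γ.treeEmbedding x y) + Γ.extraction.piE (Γ.treeEmbedding x y) =
      (Γ x).tree.poly y := by
  rw [piE_treeEmbedding]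
  exact (Γ x).attachment.rest_add_sum_lower y

theorem component_iso (x : τ.Node) :
    (Γ.extraction.component (Γ.baseEmbedding x) (Γ.baseEmbedding_notMem_edges x)).Iso
      (Γ x).tree := by
  refine DecTree.Iso.symm ⟨Equiv.ofBijective
    (fun y => ⟨Γ.treeEmbedding x y, Γ.top_treeEmbedding x y⟩) ⟨?_, ?_⟩, rfl, fun y => ?_,
    Γ.nA_add_piE_treeEmbedding x, fun y => ((Γ x).ext_eq_zero y).symm,
    fun y hy => Γ.gluedEdge_mk hy⟩
  · exact fun y z h => (Γ.treeEmbedding x).injective (congrArg Subtype.val h)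
  · rintro ⟨p, hp⟩
    obtain ⟨y, rfl⟩ := Γ.top_eq_baseEmbedding_iff.mp hp
    exact ⟨y, rfl⟩
  · apply Subtype.ext
    obtain rfl | hy := eq_or_ne y (Γ x).tree.root
    · refine Eq.trans ?_
        (congrArg Subtype.val (dif_neg (Γ.baseEmbedding_notMem_edges x))).symm
      exact congrArg (Γ.treeEmbedding x) (Γ x).tree.parent_root
    · refine Eq.trans ?_
        (congrArg Subtype.val (dif_pos (Γ.treeEmbedding_mem_edges_iff.mpr hy))).symm
      exact (Γ.gluedParent_mk hy).symm

theorem mem_negTrees_of_mem_forest {t : TreeClass d} (ht : t ∈ Γ.extraction.forest) :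
    t ∈ negTrees δ R := by
  classical
  obtain ⟨⟨p, hnodes, hedges⟩, -, rfl⟩ := Multiset.mem_map.mp ht
  obtain ⟨x, rfl⟩ := Γ.exists_baseEmbedding_eq_of_notMem_edges hedges
  have hneg : (Γ x).IsNegative := (Finset.mem_filter.mp hnodes).2
  rwa [NodeExpansion.IsNegative, DecTree.toClass, ← Quotient.sound (Γ.component_iso x)] at hneg

theorem poly_contract (x : τ.Node) :
    (Γ.extraction.contract δ).poly ⟨Γ.baseEmbedding x, Γ.baseEmbedding_notMem_edges x⟩ =
      τ.poly x := by
  classical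
  change ∑ p with Γ.extraction.top p = Γ.baseEmbedding x, (Γ.gluedPoly p - Γ.extraction.nA p) = _
  rw [filter_top_eq_baseEmbedding, Finset.sum_map]
  calc ∑ y, (Γ.gluedPoly ⟨x, y⟩ - (Γ x).attachment.rest y)
      = ∑ y, if y = (Γ x).tree.root then τ.poly x else 0 :=
        Finset.sum_congr rfl fun y _ => by rw [gluedPoly, add_tsub_cancel_left]
    _ = τ.poly x := by rw [Finset.sum_ite_eq' _ _ _, if_pos (Finset.mem_univ _)]

theorem ext_contract (x : τ.Node) :
    (Γ.extraction.contract δ).ext ⟨Γ.baseEmbedding x, Γ.baseEmbedding_notMem_edges x⟩ =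
      τ.ext x := by
  change ∑ p with Γ.extraction.top p = Γ.baseEmbedding x,
      (0 + δ.polyDeg (Γ.extraction.nA p + Γ.extraction.piE p)) +
    ∑ p ∈ Γ.extraction.edges with Γ.extraction.top p = Γ.baseEmbedding x,
      δ.edgeDeg (Γ.glue.edge p) = _
  rw [filter_top_eq_baseEmbedding, filter_edges_top_eq_baseEmbedding, Finset.sum_map,
    Finset.sum_map, ← (Γ x).degree_eq]
  congr 1
  · exact Finset.sum_congr rfl fun y _ => by rw [nA_add_piE_treeEmbedding, zero_add]
  · exact Finset.sum_congr rfl fun y hy =>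
      congrArg δ.edgeDeg (Γ.gluedEdge_mk (Finset.mem_filter.mp hy).2)

theorem contract_iso : (Γ.extraction.contract δ).Iso τ := by
  refine DecTree.Iso.symm ⟨Equiv.ofBijective
    (fun x => ⟨Γ.baseEmbedding x, Γ.baseEmbedding_notMem_edges x⟩) ⟨?_, ?_⟩, rfl, fun x => ?_,
    Γ.poly_contract, Γ.ext_contract, fun x hx => ?_⟩
  · exact fun x x' h => Γ.baseEmbedding.injective (congrArg Subtype.val h)
  · rintro ⟨p, hp⟩
    obtain ⟨x, rfl⟩ := Γ.exists_baseEmbedding_eq_of_notMem_edges hp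
    exact ⟨x, rfl⟩
  · apply Subtype.ext
    change Γ.base (τ.parent x) = Γ.extraction.top (Γ.gluedParent (Γ.base x))
    obtain rfl | hx := eq_or_ne x τ.root
    · rw [τ.parent_root, gluedParent_base_root]
      exact (Γ.top_treeEmbedding τ.root _).symm
    · rw [Γ.gluedParent_base hx]
      exact (Γ.top_treeEmbedding (τ.parent x) _).symm
  · change ((Γ.gluedEdge (Γ.base x)).1,
      (Γ.gluedEdge (Γ.base x)).2 + Γ.extraction.eA (Γ.baseEmbedding x)) = τ.edge x
    rw [gluedEdge_base, Γ.eA_baseEmbedding hx]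
    exact Prod.ext rfl (tsub_add_cancel_of_le
      ((Γ (τ.parent x)).attachment.lower_le x (DecTree.mem_children.mpr ⟨hx, rfl⟩)))

theorem toClass_mem_extTrees (Γ : Expansion δ R τ) : τ.toClass ∈ extTrees δ R :=
  ⟨Γ.glue, Γ.extraction, Γ.conforms_glue, fun _ => Γ.mem_negTrees_of_mem_forest,
    Quotient.sound Γ.contract_iso⟩

end Expansion

theorem nonempty_nodeExpansion_of_children_eq_empty (hR : 0 ∈ R) {τ : DecTree d} {x : τ.Node}
    (hchildren : τ.children x = ∅) (hext : τ.ext x = 0) : Nonempty (NodeExpansion δ R τ x) := by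
  have hsub : Subsingleton (DecTree.unit d 0).Node := inferInstanceAs (Subsingleton Unit)
  have children_unit (y : (DecTree.unit d 0).Node) : (DecTree.unit d 0).children y = ∅ :=
    Finset.filter_false_of_mem fun v _ hv => hv.1 rfl
  exact ⟨{
    tree := DecTree.unit d 0
    attachment :=
      { node := fun _ => (DecTree.unit d 0).root
        lower := 0
        not_isNoiseNode := fun _ _ => DecTree.not_isNoiseNode_root _
        lower_le := fun _ _ _ => Nat.zero_le _
        sum_lower_le := fun y => by
          simp only [Pi.zero_apply, Finset.sum_const_zero]
          exact fun _ => Nat.zero_le _ }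
    ext_eq_zero := fun _ => rfl
    edgesAt_mem := fun y => by
      simpa [Attachment.edgesAt, DecTree.outEdges, children_unit, hchildren] using hR
    degree_eq := (DecTree.degree_eq_zero_of_subsingleton rfl).trans hext.symm
    negative_or_trivial := Or.inr ⟨hsub, rfl⟩ }⟩

theorem toClass_mem_extTrees (hR : IsNormal R) {τ : DecTree d}
    (h : ∀ x, ¬ τ.IsNoiseNode x → Nonempty (NodeExpansion δ R τ x)) :
    τ.toClass ∈ extTrees δ R := by
  obtain ⟨Λ⟩ := h τ.root τ.not_isNoiseNode_root
  have zero_mem : 0 ∈ R := hR _ _ (Multiset.zero_le _) (Λ.edgesAt_mem Λ.tree.root)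
  have hall (x : τ.Node) : Nonempty (NodeExpansion δ R τ x) := by
    by_cases hx : τ.IsNoiseNode x
    · exact nonempty_nodeExpansion_of_children_eq_empty zero_mem
        (DecTree.children_eq_empty_of_isNoiseNode hx) (τ.noise_leaf x hx.1 hx.2).2.2
    · exact h x hx
  exact Expansion.toClass_mem_extTrees fun x => (hall x).some

/-- The tree whose root has extended decoration `a` and carries the edges `O`, without any other
edges or decorations. -/
def corolla (a : ℝ) (O : List (EdgeType d)) : DecTree d where
  Node := Option (Fin O.length)
  fintypeNode := inferInstance
  root := none
  parent := fun _ => none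
  parent_root := rfl
  reaches_root := fun _ => ⟨1, rfl⟩
  poly := fun _ => 0
  ext := fun v => v.elim a fun _ => 0
  edge := fun v => v.elim (EdgeKind.kernel, 0) O.get
  noise_leaf := by
    rintro (_ | v) hv _
    · exact absurd rfl hv
    · exact ⟨fun _ _ h => (nomatch h), rfl, rfl⟩

theorem outEdges_corolla_root (a : ℝ) (O : List (EdgeType d)) :
    (corolla a O).outEdges (corolla a O).root = O := by
  let leaf : Fin O.length ↪ (corolla a O).Node :=
    (Function.Embedding.some : Fin O.length ↪ Option (Fin O.length))
  have children_root : (corolla a O).children (corolla a O).root = Finset.univ.map leaf := by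
    ext v
    rw [DecTree.mem_children, Finset.mem_map]
    cases v with
    | none => exact ⟨fun h => absurd rfl h.1, by rintro ⟨_, _, h⟩; cases h⟩
    | some j => exact ⟨fun _ => ⟨j, Finset.mem_univ j, rfl⟩, fun _ => ⟨nofun, rfl⟩⟩
  rw [DecTree.outEdges, children_root, Finset.map_val, Multiset.map_map]
  change Multiset.map O.get Finset.univ.val = O
  rw [Fin.univ_val_map, List.ofFn_get]

theorem children_corolla_eq_empty {a : ℝ} {O : List (EdgeType d)} {v : (corolla a O).Node}
    (hv : v ≠ (corolla a O).root) : (corolla a O).children v = ∅ :=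
  Finset.filter_false_of_mem fun _ _ h => hv h.2.symm

theorem ext_corolla_eq_zero {a : ℝ} {O : List (EdgeType d)} {v : (corolla a O).Node}
    (hv : v ≠ (corolla a O).root) : (corolla a O).ext v = 0 := by
  cases v with
  | none => exact absurd rfl hv
  | some j => rfl

theorem coe_mem_extRule_of_nodeExpansion (hR : IsNormal R) {a : ℝ} {O : List (EdgeType d)}
    (Λ : NodeExpansion δ R (corolla a O) (corolla a O).root) :
    (O : Multiset (EdgeType d)) ∈ extRule δ R a := by
  have zero_mem : 0 ∈ R := hR _ _ (Multiset.zero_le _) (Λ.edgesAt_mem Λ.tree.root)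
  refine ⟨corolla a O, toClass_mem_extTrees hR fun v _ => ?_, rfl, outEdges_corolla_root a O⟩
  obtain rfl | hv := eq_or_ne v (corolla a O).root
  · exact ⟨Λ⟩
  · exact nonempty_nodeExpansion_of_children_eq_empty zero_mem (children_corolla_eq_empty hv)
      (ext_corolla_eq_zero hv)

end RegTrees

open RegTrees in
/-- If `R` is not subcritical, `M_g^* 1^a` may be an infinite sum; the `finsum` in `act` then takes
the value `0` if infinitely many of its terms are non-zero. -/
theorem mainTheorem10_general {d : ℕ} {δ : DegreeMap d} {R : Set (Multiset (EdgeType d))}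
    (hR : IsNormal R) {F : JetFun d} (hF : IsNonlinearity F)
    (hobey : Obeys F R) {FF : ℝ → JetFun d} (hFF : FF ∈ orbit δ R F) :
    (∀ (a : ℝ) (O : List (EdgeType d)), (O : Multiset (EdgeType d)) ∉ extRule δ R a →
      pderivs O (FF a) = 0) ∧
    ∀ τ : DecTree d, τ.toClass ∉ extTrees δ R → upsilon FF τ = 0 := by
  obtain ⟨g, rfl⟩ := hFF
  constructor
  · intro a O hO
    contrapose! hO
    obtain ⟨Λ⟩ := nonempty_nodeExpansion (τ := corolla a O) hR hF hobey
      (outEdges_corolla_root a O).symm hO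
    exact coe_mem_extRule_of_nodeExpansion hR Λ
  · intro τ hτ
    contrapose! hτ
    exact toClass_mem_extTrees hR fun x hx => nonempty_nodeExpansion hR hF hobey
      (Multiset.coe_toList _) (pderivs_toList_ne_zero_of_upsilon_ne_zero hτ hx)

theorem mainTheorem10 {d : ℕ} (δ : RegTrees.DegreeMap d)
    (R : Set (Multiset (RegTrees.EdgeType d)))
    (hnormal : RegTrees.IsNormal R) (hsub : RegTrees.IsSubcritical δ R)
    (F : RegTrees.JetFun d) (hF : RegTrees.IsNonlinearity F) (hobey : RegTrees.Obeys F R)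
    (FF : ℝ → RegTrees.JetFun d) (hFF : FF ∈ RegTrees.orbit δ R F) :
    (∀ (a : ℝ) (O : List (RegTrees.EdgeType d)),
      (O : Multiset (RegTrees.EdgeType d)) ∉ RegTrees.extRule δ R a →
        RegTrees.pderivs O (FF a) = 0) ∧
    ∀ τ : RegTrees.DecTree d, τ.toClass ∉ RegTrees.extTrees δ R →
      RegTrees.upsilon FF τ = 0 :=
  mainTheorem10_general hnormal hF hobey hFF
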